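/- **Setting.** Let $d\in\{2,3\}$ and let $\Omega\subset\mathbb R^d$ be a bounded Lipschitz domain (open, connected, with boundary locally a Lipschitz graph). Let $\alpha\in(0,1]$, $\beta\in\mathbb R$, let $Q=\begin{pmatrix}c_0&-b_0\\-b_0&a_0\end{pmatrix}$ with $a_0>0$, $c_0>0$, $a_0c_0-b_0^2>0$, let $\mathcal C$ be a symmetric positive definite linear map on $\mathbb R^{d\times d}_{\rm sym}$ (with respect to the product $A:B=\sum_{ij}A_{ij}B_{ij}$), and let $\mathcal A=\mathcal C^{-1}$. Fix $r>\tfrac12$ and $\sigma,\gamma\in\mathbb R$. **Meshes.** $\mathcal T_h$ denotes a partition of $\overline\Omega$ into finitely many closed elements with pairwise disjoint interiors, which are triangles or convex quadrilaterals if $d=2$, tetrahedra or parallelepipeds if $d=3$; hanging nodes are allowed. The set $\mathcal F(K)$ of the faces of $K\in\mathcal T_h$ consists of the sets $K\cap K'$ with $K'\in\mathcal T_h$, $K'\ne K$ (interior faces), and of the sets $G\cap\partial\Omega$ with $G$ a side of the polytope $K$ (boundary faces), in so far as they have positive $(d-1)$-dimensional measure. Let $\mathcal F_h=\bigcup_K\mathcal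 F(K)$, let $h_K,h_F$ be the diameters of $K,F$, let $h=\max_K h_K$, and let $n_K$ be the outward unit normal of $K$. The mesh is *shape-regular with constant $\sigma$* if each $K$ contains a closed ball of some radius $\rho>0$ with $h_K\le\sigma\rho$, and *locally quasi-uniform with constant $\gamma$* if $h_F\le h_K\le\gamma h_F$ for all $K\in\mathcal T_h$, $F\in\mathcal F(K)$. **Spaces.** For an integer $k\ge0$, $\mathcal P_k(K)$ is the space of polynomials on $K$ of total degree at most $k$ if $K$ is a triangle or tetrahedron, and of degree at most $k$ in each variable if $K$ is a quadrilateral or parallelepiped, the variables being those of an arbitrarily chosen affine coordinate system attached to $K$ (for example the Cartesian one, or one along the edges). $\mathcal H_{2,h}$ is the space of all $\Phi=(\tau,[z;\varphi])\in L^2(\Omega,\mathbb R^{d\times d}_{\rm sym})\times[L^2(\Omega)]^2$ whose components belong to $\mathcal P_k(K)$ on each $K$, and $$\|\Phi\|_{\mathcal H_2}^2=\int_\Omega \mathcal A\tau:\tau+\int_\Omega Q\begin{pmatrix}z\\\varphi\end{pmatrix}\cdot\begin{pmatrix}z\\\varphi\end{pmatrix}.$$ $\mathcal U$ is the space of all triples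 $\underline v=[v\mid w\mid s]$ of fields in $L^2(\Omega,\mathbb R^d)$ with $v|_K\in H^1(K,\mathbb R^d)$ and $w|_K,s|_K\in H(\operatorname{div},K)\cap H^r(K,\mathbb R^d)$ for all $K$. $\hat{\mathcal U}$ is the space of all triples $\underline{\hat v}=[\hat v\mid\hat w\mid\hat s]$ of fields in $L^2(\mathcal F_h,\mathbb R^d)$ (square-integrable and single-valued on each face) such that $\hat v=0$ on every boundary face. With $\varepsilon(v)=\frac12(\nabla v+\nabla v^{\mathsf T})$ taken elementwise, and with traces taken from inside $K$ in the integrals over $F\in\mathcal F(K)$, put $$|(\underline v,\underline{\hat v})|_{\mathcal U\times\hat{\mathcal U}}^2=\sum_{K\in\mathcal T_h}\Big(\int_K|\varepsilon(v)|^2+\int_K|\operatorname{div}w|^2+\int_K|\operatorname{div}s|^2+\sum_{F\in\mathcal F(K)}\frac{(k+1)^2}{h_F}\int_F\big(|v-\hat v|^2+|w-\hat w|^2+|s-\hat s|^2\big)\Big),$$ $$\begin{aligned}B_h(\Phi,(\underline v,\underline{\hat v}))=\sum_{K\in\mathcal T_h}\Big(&\int_K(\tau-(\alpha z+\beta\varphi)I_d):\varepsilon(v)-\int_K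 z\operatorname{div}w-\int_K\varphi\operatorname{div}s\\&+\sum_{F\in\mathcal F(K)}\int_F\big[-(\tau-(\alpha z+\beta\varphi)I_d)n_K\cdot(v-\hat v)+z\,n_K\cdot(w-\hat w)+\varphi\,n_K\cdot(s-\hat s)\big]\Big).\end{aligned}$$ **Proposition.** There is a constant $C>0$, depending only on $d,\Omega,\alpha,\beta,Q,\mathcal C,r,\sigma,\gamma$ (in particular not on $h$ and $k$), such that for every mesh $\mathcal T_h$ of $\Omega$ that is shape-regular with constant $\sigma$ and locally quasi-uniform with constant $\gamma$, every integer $k\ge0$, every $\Phi_h\in\mathcal H_{2,h}$ and every $(\underline v,\underline{\hat v})\in\mathcal U\times\hat{\mathcal U}$, $$|B_h(\Phi_h,(\underline v,\underline{\hat v}))|\le C\,\|\Phi_h\|_{\mathcal H_2}\,|(\underline v,\underline{\hat v})|_{\mathcal U\times\hat{\mathcal U}}.$$ -/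

import Mathlib

namespace HDG

open MeasureTheory Filter Topology
open scoped ContDiff MeasureTheory Pointwise

noncomputable section

/-- Euclidean space `ℝᵈ`. -/
abbrev E (d : ℕ) := EuclideanSpace ℝ (Fin d)

/-! ### Material data -/

/-- Symmetric real `d × d` matrices. -/
def symMat (d : ℕ) : Submodule ℝ (Matrix (Fin d) (Fin d) ℝ) where
  carrier := {A | A.IsSymm}
  add_mem' := fun ha hb => ha.add hb
  zero_mem' := Matrix.isSymm_zero
  smul_mem' := fun c _ ha => ha.smul c

/-- The Frobenius product `A : B`. -/
def frob {d : ℕ} (A B : Matrix (Fin d) (Fin d) ℝ) : ℝ := ∑ i, ∑ j, A i j * B i j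

theorem frob_self_nonneg {d : ℕ} (A : Matrix (Fin d) (Fin d) ℝ) : 0 ≤ frob A A :=
  Finset.sum_nonneg fun _ _ => Finset.sum_nonneg fun _ _ => mul_self_nonneg _

theorem eq_zero_of_frob_self {d : ℕ} {A : Matrix (Fin d) (Fin d) ℝ} (h : frob A A = 0) :
    A = 0 := by
  have h1 := (Finset.sum_eq_zero_iff_of_nonneg
    (fun i _ => Finset.sum_nonneg fun j _ => mul_self_nonneg (A i j))).1 h
  ext i j
  have h2 := (Finset.sum_eq_zero_iff_of_nonneg
    (fun j _ => mul_self_nonneg (A i j))).1 (h1 i (Finset.mem_univ _)) j (Finset.mem_univ _)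
  simpa using h2

/-- The material parameters entering the pairing of stress, pressure and temperature:
the Biot-Willis coefficient `α ∈ (0,1]`, the thermal coupling `β`, the entries of
`Q = [[c₀, -b₀], [-b₀, a₀]]`, which is positive definite, and the symmetric positive definite
elasticity tensor `𝒞` acting on symmetric matrices. -/
structure Material (d : ℕ) where
  α : ℝ
  β : ℝ
  c₀ : ℝ
  a₀ : ℝ
  b₀ : ℝ
  elasticity : symMat d →ₗ[ℝ] symMat d
  α_pos : 0 < α
  α_le_one : α ≤ 1
  c₀_pos : 0 < c₀
  a₀_pos : 0 < a₀
  det_pos : 0 < a₀ * c₀ - b₀ ^ 2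
  elasticity_symm : ∀ ζ ξ : symMat d,
    frob (elasticity ζ).1 ξ.1 = frob ζ.1 (elasticity ξ).1
  elasticity_bounds : ∃ cm cp : ℝ, 0 < cm ∧ cm < cp ∧ ∀ ζ : symMat d,
    cm * frob ζ.1 ζ.1 ≤ frob (elasticity ζ).1 ζ.1 ∧
      frob (elasticity ζ).1 ζ.1 ≤ cp * frob ζ.1 ζ.1

theorem Material.elasticity_injective {d : ℕ} (M : Material d) :
    Function.Injective M.elasticity := by
  rw [injective_iff_map_eq_zero]
  intro ζ hζ
  obtain ⟨cm, cp, hcm, -, h⟩ := M.elasticity_bounds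
  have h1 := (h ζ).1
  have h2 : frob (M.elasticity ζ).1 ζ.1 = 0 := by simp [hζ, frob]
  rw [h2] at h1
  have h3 := frob_self_nonneg ζ.1
  have h4 : frob ζ.1 ζ.1 = 0 := by nlinarith
  exact Subtype.ext (eq_zero_of_frob_self h4)

/-- The compliance tensor `𝒜 = 𝒞⁻¹`. -/
def Material.compliance {d : ℕ} (M : Material d) : symMat d ≃ₗ[ℝ] symMat d :=
  (LinearEquiv.ofInjectiveEndo M.elasticity M.elasticity_injective).symm

/-! ### Sobolev spaces on an element, weak derivatives and traces -/

/-- Test functions on the interior of `K`. -/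
def IsTest {d : ℕ} (K : Set (E d)) (ψ : E d → ℝ) : Prop :=
  ContDiff ℝ ∞ ψ ∧ HasCompactSupport ψ ∧ tsupport ψ ⊆ interior K

/-- The classical partial derivative `∂ψ/∂xᵢ`. -/
def pderiv {d : ℕ} (i : Fin d) (ψ : E d → ℝ) (x : E d) : ℝ :=
  fderiv ℝ ψ x (EuclideanSpace.single i 1)

/-- `g` is the weak partial derivative `∂u/∂xᵢ` in the interior of `K`. -/
def HasWeakPartial {d : ℕ} (K : Set (E d)) (i : Fin d) (u g : E d → ℝ) : Prop :=
  ∀ ψ, IsTest K ψ → ∫ x in K, u x * pderiv i ψ x = -∫ x in K, g x * ψ x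

/-- `g` is the weak divergence of the vector field `w` in the interior of `K`. -/
def HasWeakDiv {d : ℕ} (K : Set (E d)) (w : E d → E d) (g : E d → ℝ) : Prop :=
  ∀ ψ, IsTest K ψ → ∫ x in K, ∑ i, w x i * pderiv i ψ x = -∫ x in K, g x * ψ x

/-- The square of the Sobolev-Slobodeckij seminorm of order `s ∈ (0,1)` on `K`. -/
def slobodeckij {d : ℕ} (K : Set (E d)) (s : ℝ) (u : E d → ℝ) : ENNReal :=
  ∫⁻ x in K, ∫⁻ y in K, ‖u x - u y‖ₑ ^ 2 / edist x y ^ ((d : ℝ) + 2 * s)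

/-- Membership in `H^{m+s}(K)` for an integer `m` and `0 ≤ s < 1`. -/
def MemSobolevAux {d : ℕ} (K : Set (E d)) (s : ℝ) : ℕ → (E d → ℝ) → Prop
  | 0, u => MemLp u 2 (volume.restrict K) ∧ (0 < s → slobodeckij K s u < ⊤)
  | m + 1, u => MemLp u 2 (volume.restrict K) ∧
      ∀ i, ∃ g, HasWeakPartial K i u g ∧ MemSobolevAux K s m g

/-- Membership in the Sobolev space `H^r(K)`, `r ≥ 0`. -/
def MemSobolev {d : ℕ} (K : Set (E d)) (r : ℝ) (u : E d → ℝ) : Prop :=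
  MemSobolevAux K (r - ⌊r⌋₊) ⌊r⌋₊ u

/-- Membership in `H(div, K)`. -/
def MemHdiv {d : ℕ} (K : Set (E d)) (w : E d → E d) : Prop :=
  MemLp w 2 (volume.restrict K) ∧
    ∃ g, MemLp g 2 (volume.restrict K) ∧ HasWeakDiv K w g

open Classical in
/-- The weak partial derivative in `L²(K)` (zero if there is none). -/
def weakPartial {d : ℕ} (K : Set (E d)) (i : Fin d) (u : E d → ℝ) : E d → ℝ :=
  if h : ∃ g, MemLp g 2 (volume.restrict K) ∧ HasWeakPartial K i u g then h.choose else 0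

open Classical in
/-- The weak divergence in `L²(K)` (zero if there is none). -/
def weakDiv {d : ℕ} (K : Set (E d)) (w : E d → E d) : E d → ℝ :=
  if h : ∃ g, MemLp g 2 (volume.restrict K) ∧ HasWeakDiv K w g then h.choose else 0

/-- The symmetric gradient `ε(v) = (∇v + (∇v)ᵀ)/2` on `K`. -/
def strain {d : ℕ} (K : Set (E d)) (v : E d → E d) (x : E d) : Matrix (Fin d) (Fin d) ℝ :=
  fun i j => (weakPartial K j (fun y => v y i) x + weakPartial K i (fun y => v y j) x) / 2

/-- The surface measure: `(d-1)`-dimensional Hausdorff measure, in the Euclidean normalization. -/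
def surf (d : ℕ) : Measure (E d) := μHE[d - 1]

/-- `g ∈ L²(∂K)` is the trace of `u` in the sense of `H^s(K)`, for some `s ∈ (1/2, 1)`: there are
smooth functions tending to `u` in `H^s(K)` whose restrictions to `∂K` tend to `g` in `L²(∂K)`. -/
def IsSobolevTrace {d : ℕ} (K : Set (E d)) (u g : E d → ℝ) : Prop :=
  MemLp g 2 ((surf d).restrict (frontier K)) ∧
    ∃ s : ℝ, 1 / 2 < s ∧ s < 1 ∧ ∃ f : ℕ → E d → ℝ,
      (∀ n, ContDiff ℝ ∞ (f n)) ∧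
      Tendsto (fun n => eLpNorm (f n - u) 2 (volume.restrict K)) atTop (𝓝 0) ∧
      Tendsto (fun n => slobodeckij K s (f n - u)) atTop (𝓝 0) ∧
      Tendsto (fun n => eLpNorm (f n - g) 2 ((surf d).restrict (frontier K))) atTop (𝓝 0)

open Classical in
/-- The trace of `u` on `∂K`: the boundary values if `u` is continuous up to the boundary of `K`
(after a change on a null set), and the trace in the Sobolev sense otherwise. The two agree where
both apply; every `u ∈ H^r(K)` with `r > 1/2` on a Lipschitz element `K` has a trace. -/
def trace {d : ℕ} (K : Set (E d)) (u : E d → ℝ) : E d → ℝ :=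
  if h : ∃ g, ContinuousOn g K ∧ u =ᵐ[volume.restrict K] g then h.choose
  else if h' : ∃ g, IsSobolevTrace K u g then h'.choose else 0

/-- Componentwise trace of a vector field. -/
def vtrace {d : ℕ} (K : Set (E d)) (v : E d → E d) (x : E d) : E d :=
  WithLp.toLp 2 fun i => trace K (fun y => v y i) x

/-- Componentwise trace of a field of symmetric matrices. -/
def mtrace {d : ℕ} (K : Set (E d)) (τ : E d → symMat d) (x : E d) :
    Matrix (Fin d) (Fin d) ℝ :=
  fun i j => trace K (fun y => (τ y).1 i j) x

/-! ### The domain and its meshes -/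

/-- Bounded Lipschitz domains: bounded, open, connected, and near each boundary point the part of
space strictly above the graph of a Lipschitz function, in the direction of a unit vector `e`;
the function is written as one on `ℝᵈ` that is constant along `e`. -/
structure IsLipschitzDomain {d : ℕ} (Ω : Set (E d)) : Prop where
  isOpen : IsOpen Ω
  isConnected : IsConnected Ω
  isBounded : Bornology.IsBounded Ω
  graph : ∀ x ∈ frontier Ω, ∃ (e : E d) (g : E d → ℝ) (L : NNReal) (ε : ℝ),
    ‖e‖ = 1 ∧ LipschitzWith L g ∧ (∀ y (t : ℝ), g (y + t • e) = g y) ∧ 0 < ε ∧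
      ∀ y ∈ Metric.ball x ε, y ∈ Ω ↔ g y < inner ℝ y e

/-- Nondegenerate closed triangles (`d = 2`) and tetrahedra (`d = 3`). -/
def IsSimplexCell {d : ℕ} (K : Set (E d)) : Prop :=
  ∃ p : Fin (d + 1) → E d, AffineIndependent ℝ p ∧ K = convexHull ℝ (Set.range p)

/-- Closed convex quadrilaterals (`d = 2`) and nondegenerate closed parallelepipeds (`d = 3`). -/
def IsBoxCell {d : ℕ} (K : Set (E d)) : Prop :=
  (d = 2 ∧ ∃ p : Fin 4 → E d, ConvexIndependent ℝ p ∧ K = convexHull ℝ (Set.range p)) ∨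
  (d = 3 ∧ ∃ (a : E d) (e : Fin d → E d), LinearIndependent ℝ e ∧
    K = a +ᵥ parallelepiped e)

/-- A partition of `closure Ω` into finitely many closed elements with disjoint interiors;
hanging nodes are allowed. Each element carries an affine coordinate system (for instance the
Cartesian one, or one along its edges), in which the degree "in each variable" is measured on
quadrilaterals and parallelepipeds; the total degree does not depend on it. -/
structure Mesh {d : ℕ} (Ω : Set (E d)) where
  cells : Finset (Set (E d))
  isCell : ∀ K ∈ cells, IsSimplexCell K ∨ IsBoxCell K
  cover : ⋃ K ∈ cells, K = closure Ω
  disjoint : ∀ K ∈ cells, ∀ K' ∈ cells, K ≠ K' → Disjoint (interior K) (interior K')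
  coord : Set (E d) → (E d ≃ᵃ[ℝ] E d)

/-- `n` is a unit vector, and `F ⊆ K` lies in a hyperplane orthogonal to `n` such that
`K` lies on the side opposite to `n`. -/
def IsOutwardNormal {d : ℕ} (K F : Set (E d)) (n : E d) : Prop :=
  ‖n‖ = 1 ∧ ∃ c : ℝ, (∀ x ∈ K, inner ℝ n x ≤ c) ∧ ∀ x ∈ F, inner ℝ n x = c

/-- `G` is a face of the polytope `K` of dimension `d - 1`. -/
def IsFacet {d : ℕ} (K G : Set (E d)) : Prop :=
  ∃ n : E d, ‖n‖ = 1 ∧ ∃ c : ℝ, (∀ x ∈ K, inner ℝ n x ≤ c) ∧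
    G = {x ∈ K | inner ℝ n x = c} ∧ 0 < surf d G

open Classical in
/-- The outward unit normal `n_K` of `K` on its face `F`. -/
def normal {d : ℕ} (K F : Set (E d)) : E d :=
  if h : ∃ n, IsOutwardNormal K F n then h.choose else 0

namespace Mesh

variable {d : ℕ} {Ω : Set (E d)}

/-- The set of faces that make up the boundary of `K`: the sets `K ∩ K'` with another element
`K'`, and the parts on `∂Ω` of the sides of `K`, as far as they have positive surface measure. -/
def facesOf (T : Mesh Ω) (K : Set (E d)) : Set (Set (E d)) :=
  {F | ((∃ K' ∈ T.cells, K' ≠ K ∧ F = K ∩ K') ∨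
      ∃ G, IsFacet K G ∧ F = G ∩ frontier Ω) ∧ 0 < surf d F}

/-- All faces of the mesh. -/
def faces (T : Mesh Ω) : Set (Set (E d)) := {F | ∃ K ∈ T.cells, F ∈ T.facesOf K}

/-- The boundary faces of the mesh. -/
def boundaryFaces (T : Mesh Ω) : Set (Set (E d)) :=
  {F | ∃ K ∈ T.cells, ∃ G, IsFacet K G ∧ F = G ∩ frontier Ω ∧ 0 < surf d F}

/-- Shape regularity: every element `K` contains a ball of radius `ρ` with `h_K ≤ σ ρ`. -/
def ShapeRegular (T : Mesh Ω) (σ : ℝ) : Prop :=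
  ∀ K ∈ T.cells, ∃ (x : E d) (ρ : ℝ), 0 < ρ ∧ Metric.closedBall x ρ ⊆ K ∧ Metric.diam K ≤ σ * ρ

/-- Local quasi-uniformity `h_F ≤ h_K ≤ γ h_F`. -/
def LocallyQuasiUniform (T : Mesh Ω) (γ : ℝ) : Prop :=
  ∀ K ∈ T.cells, ∀ F ∈ T.facesOf K,
    Metric.diam F ≤ Metric.diam K ∧ Metric.diam K ≤ γ * Metric.diam F

end Mesh

theorem cell_eq_convexHull {d : ℕ} {K : Set (E d)} (hK : IsSimplexCell K ∨ IsBoxCell K) :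
    ∃ S : Set (E d), S.Finite ∧ K = convexHull ℝ S := by
  rcases hK with ⟨p, -, h⟩ | ⟨-, p, -, h⟩ | ⟨-, a, e, -, h⟩
  · exact ⟨_, Set.finite_range p, h⟩
  · exact ⟨_, Set.finite_range p, h⟩
  · refine ⟨a +ᵥ ∑ i, ({0, e i} : Set (E d)), ?_, ?_⟩
    · refine Set.Finite.vadd_set ?_
      exact Finset.sum_induction _ Set.Finite (fun _ _ ha hb => ha.add hb)
        (Set.finite_singleton 0) fun i _ => Set.toFinite _
    · rw [h, parallelepiped_eq_convexHull, convexHull_vadd]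

/-- A polytope has finitely many sides. -/
theorem finite_facets {d : ℕ} {K : Set (E d)} (hK : IsSimplexCell K ∨ IsBoxCell K) :
    {G | IsFacet K G}.Finite := by
  obtain ⟨S, hS, hKS⟩ := cell_eq_convexHull hK
  have hcomp : IsCompact K := hKS ▸ hS.isCompact_convexHull ℝ
  have hconv : Convex ℝ K := hKS ▸ convex_convexHull ℝ S
  have key : ∀ G ∈ {G | IsFacet K G}, IsExposed ℝ K G := by
    rintro G ⟨n, -, c, hc, rfl, -⟩ ⟨y, hy⟩
    refine ⟨innerSL ℝ n, ?_⟩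
    ext x
    simp only [Set.mem_ofPred_eq, innerSL_apply_apply]
    constructor
    · rintro ⟨hx, hxc⟩
      exact ⟨hx, fun z hz => hxc ▸ hc z hz⟩
    · rintro ⟨hx, hxm⟩
      exact ⟨hx, le_antisymm (hc x hx) (hy.2 ▸ hxm y hy.1)⟩
  refine Set.Finite.of_finite_image (f := fun G => Set.extremePoints ℝ G)
    (hS.finite_subsets.subset ?_) ?_
  · rintro _ ⟨G, hG, rfl⟩
    refine ((key G hG).isExtreme.extremePoints_subset_extremePoints).trans ?_
    rw [hKS]
    exact extremePoints_convexHull_subset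
  · intro G hG G' hG' h
    rw [← closure_convexHull_extremePoints ((key G hG).isCompact hcomp) ((key G hG).convex hconv),
      ← closure_convexHull_extremePoints ((key G' hG').isCompact hcomp)
        ((key G' hG').convex hconv)]
    exact congrArg (fun A => closure (convexHull ℝ A)) h

/-- Each element has finitely many faces, so that the sums over its faces below are finite. -/
theorem Mesh.finite_facesOf {d : ℕ} {Ω : Set (E d)} (T : Mesh Ω) {K : Set (E d)}
    (hK : K ∈ T.cells) : (T.facesOf K).Finite := by
  refine ((T.cells.finite_toSet.image fun K' => K ∩ K').union
    ((finite_facets (T.isCell K hK)).image fun G => G ∩ frontier Ω)).subset ?_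
  rintro F ⟨⟨K', hK', -, rfl⟩ | ⟨G, hG, rfl⟩, -⟩
  · exact Or.inl ⟨K', hK', rfl⟩
  · exact Or.inr ⟨G, hG, rfl⟩

/-! ### The spaces -/

/-- Triples `[v | w | s]` of vector fields on `Ω`. -/
structure Triple (d : ℕ) where
  v : E d → E d
  w : E d → E d
  s : E d → E d

/-- Triples of vector-valued functions on the skeleton, single-valued on each face:
`v F` is the function on the face `F`. -/
structure HatTriple (d : ℕ) where
  v : Set (E d) → E d → E d
  w : Set (E d) → E d → E d
  s : Set (E d) → E d → E d

/-- `Φ = (τ, [z ; φ])` with `τ` a field of symmetric matrices and `z`, `φ` scalar fields. -/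
structure State (d : ℕ) where
  τ : E d → symMat d
  z : E d → ℝ
  φ : E d → ℝ

variable {d : ℕ} {Ω : Set (E d)}

/-- `H^r(𝒯_h, ℝᵈ)`. -/
def MemBroken (T : Mesh Ω) (r : ℝ) (v : E d → E d) : Prop :=
  MemLp v 2 (volume.restrict Ω) ∧ ∀ K ∈ T.cells, ∀ i, MemSobolev K r fun x => v x i

/-- The space `𝒰` (with the exponent `r`). -/
def U (T : Mesh Ω) (r : ℝ) : Set (Triple d) :=
  {u | MemBroken T 1 u.v ∧
    (MemBroken T r u.w ∧ ∀ K ∈ T.cells, MemHdiv K u.w) ∧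
    (MemBroken T r u.s ∧ ∀ K ∈ T.cells, MemHdiv K u.s)}

/-- `L²(ℱ_h, ℝᵈ)`. -/
def MemSkeleton (T : Mesh Ω) (g : Set (E d) → E d → E d) : Prop :=
  ∀ F ∈ T.faces, MemLp (g F) 2 ((surf d).restrict F)

/-- The space `𝒰̂`; its first component vanishes on the boundary faces. -/
def Uhat (T : Mesh Ω) : Set (HatTriple d) :=
  {u | (MemSkeleton T u.v ∧ ∀ F ∈ T.boundaryFaces, u.v F =ᵐ[(surf d).restrict F] 0) ∧
    MemSkeleton T u.w ∧ MemSkeleton T u.s}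

/-- `u` belongs to `𝒫_ℓ(K)`: on a simplex, it is a polynomial of total degree at most `ℓ`; on a
quadrilateral or parallelepiped, a polynomial of degree at most `ℓ` in each variable. -/
def IsPolyOn (T : Mesh Ω) (K : Set (E d)) (ℓ : ℕ) (u : E d → ℝ) : Prop :=
  ∃ P : MvPolynomial (Fin d) ℝ,
    ((IsSimplexCell K ∧ P.totalDegree ≤ ℓ) ∨ (IsBoxCell K ∧ ∀ i, P.degreeOf i ≤ ℓ)) ∧
    u =ᵐ[volume.restrict K] fun x => MvPolynomial.eval (fun i => T.coord K x i) P

/-- The space `𝒫_ℓ(𝒯_h)`. -/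
def IsPiecewisePoly (T : Mesh Ω) (ℓ : ℕ) (u : E d → ℝ) : Prop :=
  MemLp u 2 (volume.restrict Ω) ∧ ∀ K ∈ T.cells, IsPolyOn T K ℓ u

/-- The discrete space `ℋ_{2,h} = 𝒫_k(𝒯_h, ℝ^{d×d}_sym) × [𝒫_k(𝒯_h)]²`. -/
def H2h (T : Mesh Ω) (k : ℕ) : Set (State d) :=
  {Φ | (∀ i j, IsPiecewisePoly T k fun x => (Φ.τ x).1 i j) ∧
    IsPiecewisePoly T k Φ.z ∧ IsPiecewisePoly T k Φ.φ}

/-! ### Norms and the bilinear form -/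

/-- `‖Φ‖_{ℋ₂} = ((𝒜τ, τ)_Ω + (Q [z ; φ], [z ; φ])_Ω)^{1/2}`. -/
def H2norm (Ω : Set (E d)) (M : Material d) (Φ : State d) : ℝ :=
  √((∫ x in Ω, frob (M.compliance (Φ.τ x)).1 (Φ.τ x).1) +
    ∫ x in Ω, ((M.c₀ * Φ.z x - M.b₀ * Φ.φ x) * Φ.z x +
      (-M.b₀ * Φ.z x + M.a₀ * Φ.φ x) * Φ.φ x))

/-- The seminorm of `𝒰 × 𝒰̂` for the polynomial degree `k`. -/
def Useminorm (T : Mesh Ω) (k : ℕ) (u : Triple d) (uh : HatTriple d) : ℝ :=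
  √(∑ K ∈ T.cells,
    ((∫ x in K, frob (strain K u.v x) (strain K u.v x)) +
      (∫ x in K, weakDiv K u.w x ^ 2) + (∫ x in K, weakDiv K u.s x ^ 2) +
      ∑ᶠ F ∈ T.facesOf K, ((k : ℝ) + 1) ^ 2 / Metric.diam F *
        ∫ x in F, (‖vtrace K u.v x - uh.v F x‖ ^ 2 + ‖vtrace K u.w x - uh.w F x‖ ^ 2 +
          ‖vtrace K u.s x - uh.s F x‖ ^ 2) ∂(surf d)))

/-- The total stress `τ - (α z + β φ) I` built from values of `τ`, `z`, `φ`. -/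
def totalStress (M : Material d) (τ : Matrix (Fin d) (Fin d) ℝ) (z φ : ℝ) :
    Matrix (Fin d) (Fin d) ℝ :=
  τ - (M.α * z + M.β * φ) • (1 : Matrix (Fin d) (Fin d) ℝ)

/-- The bilinear form `B_h(Φ, (u, uh))`. -/
def Bh (M : Material d) (T : Mesh Ω) (Φ : State d) (u : Triple d) (uh : HatTriple d) : ℝ :=
  ∑ K ∈ T.cells,
    ((∫ x in K, frob (totalStress M (Φ.τ x).1 (Φ.z x) (Φ.φ x)) (strain K u.v x)) -
      (∫ x in K, Φ.z x * weakDiv K u.w x) - (∫ x in K, Φ.φ x * weakDiv K u.s x)) +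
  ∑ K ∈ T.cells, ∑ᶠ F ∈ T.facesOf K,
    (-(∫ x in F, inner ℝ
          (WithLp.toLp 2 ((totalStress M (mtrace K Φ.τ x) (trace K Φ.z x) (trace K Φ.φ x)).mulVec
            (normal K F)) : E d)
          (vtrace K u.v x - uh.v F x) ∂(surf d)) +
      (∫ x in F, inner ℝ (trace K Φ.z x • normal K F) (vtrace K u.w x - uh.w F x) ∂(surf d)) +
      ∫ x in F, inner ℝ (trace K Φ.φ x • normal K F) (vtrace K u.s x - uh.s F x) ∂(surf d))

end

end HDG

/-!
The bilinear form is bounded by the Cauchy-Schwarz inequality, term by term, once the boundary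
integrals of the piecewise polynomial `Φ` are controlled by its integrals over the elements. The
point is the discrete trace inequality `integral_face_trace_sq_le`,
`h_F (k + 1)⁻² ∫_F p² ≤ C ∫_K p²`, with a constant that depends on the mesh only through `σ`.

*Trace inequality.* If `q` is a polynomial of degree `m` in one variable, Markov's inequality at an
end point, applied to the antiderivative of `q²` (of degree `2 m + 1`), gives
`q(1)² ≤ 4 (2 m + 1)² ∫_{1/2}^1 q²` (`sq_eval_one_le`). A face `F` of `K` lies in a supporting
hyperplane of `K`, since the interiors of neighbouring elements are separated by a hyperplane, and
`K` contains a ball of radius `ρ ≥ h_K / σ`. The cone over `F` whose apex is the centre of the ball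
lies in `K` by convexity and has height at least `ρ`. Applying the inequality along the segments
from the apex to the points of `F`, and integrating over the frustum swept by the outer halves of
the segments (`lintegral_face_le`), bounds `∫_F p²` by `C (k + 1)² ρ⁻¹ ∫_K p²`. No reference
element is needed, and the shape of the element and of its faces plays no role.

*Number of faces.* Each face of `K` uses the integral over all of `K`, so the number of faces has to
be bounded (`Mesh.ncard_facesOf_le`). The neighbours of `K` across faces have sizes comparable to
`h_K` by local quasi-uniformity, and contain disjoint balls of comparable radius, so that their
number is bounded by a volume comparison; the boundary faces are counted by the sides of `K`.

*Norms.* The norm of `ℋ₂` controls the `L²` norm (`exists_integral_energy_le`), because the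
elasticity tensor is bounded and `Q` is positive definite. The elements overlap in null sets and
fill no more than `Ω` up to a null set, because a Lipschitz domain is the interior of its closure.

*Cauchy-Schwarz.* All products are estimated by Young's inequality with one free parameter `t`,
scaled by `h_F / (k + 1)²` on the face `F`, so that the estimates can be added up without square
roots; optimizing over `t` at the end (`le_two_mul_sqrt_mul_sqrt`) gives the product of the norms.
-/

namespace HDG

open MeasureTheory Filter Topology
open scoped ContDiff MeasureTheory Pointwise

noncomputable section

/-! ### The trace inequality in one variable -/

theorem exists_antiderivative (p : Polynomial ℝ) :
    ∃ q : Polynomial ℝ, q.derivative = p ∧ q.natDegree ≤ p.natDegree + 1 := by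
  refine ⟨∑ i ∈ Finset.range (p.natDegree + 1),
    Polynomial.monomial (i + 1) (p.coeff i / (i + 1)), ?_, ?_⟩
  · conv_rhs => rw [p.as_sum_range]
    rw [Polynomial.derivative_sum]
    refine Finset.sum_congr rfl fun i _ => ?_
    rw [Polynomial.derivative_monomial]
    congr 1
    push_cast
    field_simp
  · refine Polynomial.natDegree_sum_le_of_forall_le _ _ fun i hi => ?_
    refine (Polynomial.natDegree_monomial_le _).trans ?_
    have := Finset.mem_range.1 hi
    omega

/-- Markov's inequality at an end point, applied to the antiderivative of `q ^ 2`, bounds the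
boundary value of `q` by its mean square with the sharp growth in the degree. -/
theorem sq_eval_one_le (q : Polynomial ℝ) {n : ℕ} (hq : q.natDegree ≤ n) :
    q.eval 1 ^ 2 ≤ 4 * (2 * n + 1) ^ 2 * ∫ t in (1 / 2 : ℝ)..1, q.eval t ^ 2 := by
  obtain ⟨P, hP, hPdeg⟩ := exists_antiderivative (q ^ 2)
  have hPd (x : ℝ) : HasDerivAt (fun y => P.eval y) (q.eval x ^ 2) x := by
    simpa [hP] using P.hasDerivAt x
  have hcont : Continuous fun t => q.eval t ^ 2 := by fun_prop
  have hint (a b : ℝ) : ∫ t in a..b, q.eval t ^ 2 = P.eval b - P.eval a :=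
    intervalIntegral.integral_eq_sub_of_hasDerivAt (fun x _ => hPd x)
      (hcont.intervalIntegrable _ _)
  have hdeg : P.natDegree ≤ 2 * n + 1 := by
    have : (q ^ 2).natDegree ≤ 2 * n := Polynomial.natDegree_pow_le_of_le 2 hq
    omega
  set I := ∫ t in (1 / 2 : ℝ)..1, q.eval t ^ 2 with hI
  have hI0 : 0 ≤ I := intervalIntegral.integral_nonneg (by norm_num) fun _ _ => sq_nonneg _
  -- strict inequality allows division by `J`, also when the integral vanishes
  have key : ∀ J, I < J → q.eval 1 ^ 2 ≤ 4 * (2 * n + 1) ^ 2 * J := by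
    intro J hJ
    have hJ0 : 0 < J := hI0.trans_lt hJ
    -- the antiderivative, moved from `[1/2, 1]` to `[-1, 1]` and normalized
    let R : Polynomial ℝ := Polynomial.C J⁻¹ *
      ((P - Polynomial.C (P.eval (1 / 2))).comp
        (Polynomial.C (1 / 4) * Polynomial.X + Polynomial.C (3 / 4)))
    have hRdeg : R.degree ≤ ((2 * n + 1 : ℕ) : WithBot ℕ) := by
      refine Polynomial.degree_le_of_natDegree_le ?_
      refine (Polynomial.natDegree_C_mul_le _ _).trans ?_
      refine Polynomial.natDegree_comp_le.trans ?_
      have h1 : (P - Polynomial.C (P.eval (1 / 2))).natDegree ≤ 2 * n + 1 := by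
        rw [Polynomial.natDegree_sub_C]; exact hdeg
      have h2 : (Polynomial.C (1 / 4 : ℝ) * Polynomial.X + Polynomial.C (3 / 4)).natDegree ≤ 1 :=
        Polynomial.natDegree_linear_le
      calc _ ≤ (2 * n + 1) * 1 := Nat.mul_le_mul h1 h2
        _ = _ := by ring
    have hRb : ∀ x ∈ Set.Icc (-1 : ℝ) 1, |R.eval x| ≤ 1 := by
      intro x hx
      have hR : R.eval x = J⁻¹ * ∫ t in (1 / 2 : ℝ)..(1 / 4 * x + 3 / 4), q.eval t ^ 2 := by
        rw [hint]; simp [R]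
      have hx1 : (1 / 2 : ℝ) ≤ 1 / 4 * x + 3 / 4 := by linarith [hx.1]
      have hx2 : 1 / 4 * x + 3 / 4 ≤ (1 : ℝ) := by linarith [hx.2]
      have h0 : 0 ≤ ∫ t in (1 / 2 : ℝ)..(1 / 4 * x + 3 / 4), q.eval t ^ 2 :=
        intervalIntegral.integral_nonneg hx1 fun _ _ => sq_nonneg _
      have h1 : ∫ t in (1 / 2 : ℝ)..(1 / 4 * x + 3 / 4), q.eval t ^ 2 ≤ I :=
        intervalIntegral.integral_mono_interval le_rfl hx1 hx2
          (Eventually.of_forall fun _ => sq_nonneg _) (hcont.intervalIntegrable _ _)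
      rw [hR, abs_of_nonneg (by positivity), inv_mul_le_iff₀ hJ0]
      linarith
    have h := Polynomial.Chebyshev.eval_iterate_derivative_le_of_forall_abs_le_one
      (k := 1) (x := 1) le_rfl hRdeg hRb
    simp only [Function.iterate_one, Polynomial.Chebyshev.derivative_T_eval_one] at h
    have hR' : R.derivative.eval 1 = J⁻¹ * (1 / 4 * q.eval 1 ^ 2) := by
      simp [R, Polynomial.derivative_comp, hP]
      norm_num
    rw [hR', inv_mul_le_iff₀ hJ0] at h
    push_cast at h
    linarith
  have h4 : (0 : ℝ) < 4 * (2 * n + 1) ^ 2 := by positivity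
  rw [← div_le_iff₀' h4]
  refine le_of_forall_gt_imp_ge_of_dense fun J hJ => ?_
  rw [div_le_iff₀' h4]
  exact key J hJ

/-! ### Integration over a cone with a flat base -/

/-- The slice decomposition of space by the hyperplanes orthogonal to a unit vector `n`: the
point at signed height `q.1` above `x₀ + n^⊥`, with orthogonal component `q.2`. -/
def sliceMap {d : ℕ} (n x₀ : E d) (q : ℝ × ↥(ℝ ∙ n)ᗮ) : E d := x₀ + (q.1 • n + q.2)

theorem continuous_sliceMap {d : ℕ} (n x₀ : E d) : Continuous (sliceMap n x₀) := by
  unfold sliceMap; fun_prop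

theorem measurePreserving_sliceMap {d : ℕ} {n : E d} (hn : ‖n‖ = 1) (x₀ : E d) :
    MeasurePreserving (sliceMap n x₀) := by
  have h1 := ((ℝ ∙ n).measurePreserving_measurableEquivProd x₀).symm
  have h2 := (LinearIsometryEquiv.toSpanUnitSingleton (𝕜 := ℝ) n hn).measurePreserving.prod
    (MeasurePreserving.id (volume : Measure ↥(ℝ ∙ n)ᗮ))
  have h3 := h1.comp h2
  rw [InnerProductSpace.euclideanHausdorffMeasure_eq_volume] at h3
  convert! h3 using 1
  funext q
  simp [sliceMap, add_comm]

theorem finrank_orthogonal_unit {d : ℕ} {n : E d} (hn : ‖n‖ = 1) :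
    Module.finrank ℝ ↥(ℝ ∙ n)ᗮ = d - 1 := by
  have h := (ℝ ∙ n).finrank_add_finrank_orthogonal
  rw [finrank_span_singleton (by rintro rfl; simp at hn), finrank_euclideanSpace_fin] at h
  omega

theorem exists_sliceMap {d : ℕ} {n : E d} (hn : ‖n‖ = 1) (x₀ : E d) {x : E d} :
    ∃ z, sliceMap n x₀ (inner ℝ n x - inner ℝ n x₀, z) = x := by
  refine ⟨⟨x - x₀ - (inner ℝ n x - inner ℝ n x₀) • n, ?_⟩, ?_⟩
  · rw [Submodule.mem_orthogonal_singleton_iff_inner_right]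
    simp [inner_sub_right, inner_smul_right, hn]
  · simp [sliceMap]

/-- On a hyperplane the surface measure is the Lebesgue measure of the parameter space. -/
theorem lintegral_surf_hyperplane {d : ℕ} {n : E d} (hn : ‖n‖ = 1) (x₀ : E d) {c : ℝ}
    {F : Set (E d)} (hF : MeasurableSet F) (hFc : ∀ x ∈ F, inner ℝ n x = c)
    {f : E d → ENNReal} (hf : Measurable f) :
    ∫⁻ x in F, f x ∂(surf d) =
      ∫⁻ z, F.indicator f (sliceMap n x₀ (c - inner ℝ n x₀, z)) := by
  set g : ↥(ℝ ∙ n)ᗮ → E d := fun z => sliceMap n x₀ (c - inner ℝ n x₀, z) with hg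
  have hiso : Isometry g := by
    refine Isometry.of_dist_eq fun z z' => ?_
    simp [hg, sliceMap, Subtype.dist_eq]
  have hmap := hiso.map_euclideanHausdorffMeasure (d := d - 1)
  have hvol : (μHE[d - 1] : Measure ↥(ℝ ∙ n)ᗮ) = volume := by
    rw [← finrank_orthogonal_unit hn, InnerProductSpace.euclideanHausdorffMeasure_eq_volume]
  have hsub : F ⊆ Set.range g := by
    intro x hx
    obtain ⟨z, hz⟩ := exists_sliceMap hn x₀ (x := x)
    exact ⟨z, by rw [hg, ← hFc x hx]; exact hz⟩
  have : (surf d).restrict F = ((volume : Measure ↥(ℝ ∙ n)ᗮ).map g).restrict F := by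
    rw [← hvol, hmap, Measure.restrict_restrict hF, Set.inter_eq_left.2 hsub, surf]
  rw [this, ← lintegral_indicator hF, lintegral_map (hf.indicator hF) hiso.continuous.measurable]

theorem lintegral_comp_smul {V : Type*} [NormedAddCommGroup V] [NormedSpace ℝ V]
    [MeasurableSpace V] [BorelSpace V] [FiniteDimensional ℝ V] (μ : Measure V)
    [μ.IsAddHaarMeasure] {t : ℝ} (ht : 0 < t) (f : V → ENNReal) :
    ∫⁻ z, f z ∂μ = ENNReal.ofReal (t ^ Module.finrank ℝ V) * ∫⁻ z, f (t • z) ∂μ := by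
  have h := (Homeomorph.smulOfNeZero t ht.ne').measurableEmbedding.lintegral_map (μ := μ) f
  have h2 := Measure.map_addHaar_smul μ ht.ne'
  simp only [Homeomorph.smulOfNeZero_apply] at h
  change ∫⁻ a, f a ∂(Measure.map (t • ·) μ) = _ at h
  rw [h2, lintegral_smul_measure] at h
  rw [← h, smul_eq_mul, ← mul_assoc, ← ENNReal.ofReal_mul (by positivity), abs_of_pos (by positivity),
    mul_inv_cancel₀ (by positivity)]
  simp

/-- If `f` at each point of a flat piece `F` of the boundary of a convex set `K` is controlled by
its integral along the segment to `x₀ ∈ K`, then the integral of `f` over `F` is controlled by the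
integral over `K`: integrate over the frustum of the cone with base `F` and apex `x₀`, whose slices
are homothetic to `F` with ratios in `[1/2, 1]`. -/
theorem lintegral_face_le {d : ℕ} {n x₀ : E d} (hn : ‖n‖ = 1) {K F : Set (E d)}
    (hK : Convex ℝ K) (hKm : MeasurableSet K) (hx₀ : x₀ ∈ K) (hFK : F ⊆ K)
    (hF : MeasurableSet F) {c : ℝ}
    (hFc : ∀ x ∈ F, inner ℝ n x = c) {ρ : ℝ} (hρ : 0 < ρ) (hc : ρ ≤ c - inner ℝ n x₀)
    {f : E d → ENNReal} (hf : Measurable f) (D : ENNReal)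
    (hD : ∀ y ∈ F, f y ≤ D * ∫⁻ t in Set.Icc (1 / 2 : ℝ) 1, f (x₀ + t • (y - x₀))) :
    ∫⁻ x in F, f x ∂(surf d) ≤ D * ENNReal.ofReal (2 ^ (d - 1) / ρ) * ∫⁻ x in K, f x := by
  set h := c - inner ℝ n x₀ with hh
  have hh0 : 0 < h := hρ.trans_le hc
  set m := d - 1 with hm
  set F' : Set ↥(ℝ ∙ n)ᗮ := {z | sliceMap n x₀ (h, z) ∈ F} with hF'
  have hF'm : MeasurableSet F' :=
    ((continuous_sliceMap n x₀).comp (Continuous.prodMk_right h)).measurable hF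
  have hscale (t : ℝ) (z : ↥(ℝ ∙ n)ᗮ) : sliceMap n x₀ (h * t, t • z) =
      x₀ + t • (sliceMap n x₀ (h, z) - x₀) := by
    simp [sliceMap, smul_smul, mul_comm]
  have hmem : ∀ t ∈ Set.Icc (1 / 2 : ℝ) 1, ∀ z ∈ F', sliceMap n x₀ (h * t, t • z) ∈ K := by
    intro t ht z hz
    rw [hscale]
    exact hK.add_smul_sub_mem hx₀ (hFK hz) ⟨by linarith [ht.1], ht.2⟩
  have hfK : Measurable (K.indicator f) := hf.indicator hKm
  have hmeas : Measurable fun q : ℝ × ↥(ℝ ∙ n)ᗮ =>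
      f (x₀ + q.1 • (sliceMap n x₀ (h, q.2) - x₀)) := by
    refine hf.comp (Continuous.measurable ?_)
    unfold sliceMap
    fun_prop
  -- the frustum in the coordinates (height, foot point), by Fubini and the scaling of each slice
  have hlow : ENNReal.ofReal h * (ENNReal.ofReal ((1 / 2) ^ m) *
      ∫⁻ t in Set.Icc (1 / 2 : ℝ) 1, ∫⁻ z in F',
        f (x₀ + t • (sliceMap n x₀ (h, z) - x₀))) ≤ ∫⁻ x in K, f x := by
    rw [← lintegral_indicator hKm,
      ← (measurePreserving_sliceMap hn x₀).lintegral_comp hfK, Measure.volume_eq_prod,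
      lintegral_prod (fun q => K.indicator f (sliceMap n x₀ q))
        (hfK.comp (continuous_sliceMap n x₀).measurable).aemeasurable,
      lintegral_comp_smul volume hh0, Module.finrank_self, pow_one]
    gcongr
    rw [← lintegral_const_mul _ (Measurable.lintegral_prod_right' hmeas)]
    refine (setLIntegral_mono' measurableSet_Icc fun t ht => ?_).trans
      (setLIntegral_le_lintegral (Set.Icc (1 / 2 : ℝ) 1) _)
    have ht0 : 0 < t := by linarith [ht.1]
    rw [lintegral_comp_smul volume ht0, finrank_orthogonal_unit hn]
    refine mul_le_mul' (ENNReal.ofReal_le_ofReal (pow_le_pow_left₀ (by norm_num) ht.1 _)) ?_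
    rw [← lintegral_indicator hF'm]
    refine lintegral_mono fun z => ?_
    by_cases hz : z ∈ F'
    · rw [Set.indicator_of_mem hz, smul_eq_mul, Set.indicator_of_mem (hmem t ht z hz), hscale]
    · rw [Set.indicator_of_notMem hz]; exact bot_le
  -- the bound along segments, integrated over the base
  have hup : ∫⁻ x in F, f x ∂(surf d) ≤ D * ∫⁻ t in Set.Icc (1 / 2 : ℝ) 1, ∫⁻ z in F',
        f (x₀ + t • (sliceMap n x₀ (h, z) - x₀)) := by
    rw [lintegral_surf_hyperplane hn x₀ hF hFc hf,
      lintegral_lintegral_swap (f := fun t z => f (x₀ + t • (sliceMap n x₀ (h, z) - x₀)))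
        hmeas.aemeasurable,
      ← lintegral_const_mul _ (Measurable.lintegral_prod_left' hmeas), ← lintegral_indicator hF'm]
    refine lintegral_mono fun z => ?_
    by_cases hz : z ∈ F'
    · rw [Set.indicator_of_mem hz, Set.indicator_of_mem (show sliceMap n x₀ (h, z) ∈ F from hz)]
      exact hD _ hz
    · rw [Set.indicator_of_notMem (show sliceMap n x₀ (h, z) ∉ F from hz)]; exact bot_le
  refine hup.trans ?_
  rw [mul_assoc]
  gcongr
  set J := ∫⁻ t in Set.Icc (1 / 2 : ℝ) 1, ∫⁻ z in F',
        f (x₀ + t • (sliceMap n x₀ (h, z) - x₀))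
  calc J = ENNReal.ofReal (2 ^ m / h) * (ENNReal.ofReal h * (ENNReal.ofReal ((1 / 2) ^ m) * J)) := by
        rw [← mul_assoc, ← mul_assoc, ← ENNReal.ofReal_mul (by positivity),
          ← ENNReal.ofReal_mul (by positivity)]
        have : 2 ^ m / h * h * (1 / 2 : ℝ) ^ m = 1 := by
          rw [div_mul_cancel₀ _ hh0.ne', ← mul_pow]; norm_num
        rw [this]; simp
    _ ≤ ENNReal.ofReal (2 ^ m / ρ) * ∫⁻ x in K, f x := by gcongr

/-! ### The trace inequality for polynomials on a convex element -/

/-- The polynomial function `P` in the affine coordinates `A`. -/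
def polyFun {d : ℕ} (A : E d ≃ᵃ[ℝ] E d) (P : MvPolynomial (Fin d) ℝ) (x : E d) : ℝ :=
  MvPolynomial.eval (fun i => A x i) P

theorem continuous_polyFun {d : ℕ} (A : E d ≃ᵃ[ℝ] E d) (P : MvPolynomial (Fin d) ℝ) :
    Continuous (polyFun A P) := by
  have hA : Continuous A := A.toAffineMap.continuous_of_finiteDimensional
  exact P.continuous_eval.comp (by fun_prop)

/-- Along a line, a polynomial of total degree at most `m` is one of degree at most `m` in the
parameter, in any affine coordinates. -/
theorem exists_polyFun_line {d m : ℕ} (A : E d ≃ᵃ[ℝ] E d) {P : MvPolynomial (Fin d) ℝ}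
    (hP : P.totalDegree ≤ m) (x₀ y : E d) :
    ∃ q : Polynomial ℝ, q.natDegree ≤ m ∧
      ∀ t : ℝ, q.eval t = polyFun A P (x₀ + t • (y - x₀)) := by
  refine ⟨MvPolynomial.aeval (fun i => Polynomial.C (A y i - A x₀ i) * Polynomial.X +
    Polynomial.C (A x₀ i)) P, ?_, fun t => ?_⟩
  · have h := MvPolynomial.aeval_natDegree_le (n := 1) P hP
      (fun i => Polynomial.C (A y i - A x₀ i) * Polynomial.X + Polynomial.C (A x₀ i))
      fun i => Polynomial.natDegree_linear_le
    rwa [mul_one] at h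
  · have hA (i : Fin d) : A (x₀ + t • (y - x₀)) i = t * (A y i - A x₀ i) + A x₀ i := by
      have h : x₀ + t • (y - x₀) = AffineMap.lineMap x₀ y t := by
        simp [AffineMap.lineMap_apply, add_comm]
      rw [h, AffineEquiv.apply_lineMap]
      simp [AffineMap.lineMap_apply]
    rw [← Polynomial.coe_evalRingHom, MvPolynomial.map_aeval]
    simp only [polyFun, hA]
    rw [← MvPolynomial.eval₂_id]
    refine congrArg₂ (fun φ f => MvPolynomial.eval₂ φ f P) ?_ ?_
    · ext; simp
    · funext i
      simp [mul_comm]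

theorem ofReal_sq_polyFun_le {d m : ℕ} (A : E d ≃ᵃ[ℝ] E d) {P : MvPolynomial (Fin d) ℝ}
    (hP : P.totalDegree ≤ m) (x₀ y : E d) :
    ENNReal.ofReal (polyFun A P y ^ 2) ≤ ENNReal.ofReal (4 * (2 * m + 1) ^ 2) *
      ∫⁻ t in Set.Icc (1 / 2 : ℝ) 1, ENNReal.ofReal (polyFun A P (x₀ + t • (y - x₀)) ^ 2) := by
  obtain ⟨q, hq, hqe⟩ := exists_polyFun_line A hP x₀ y
  have h := sq_eval_one_le q hq
  have hy : q.eval 1 = polyFun A P y := by rw [hqe]; simp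
  simp only [← hqe, ← hy]
  rw [← ofReal_integral_eq_lintegral_ofReal, ← ENNReal.ofReal_mul (by positivity)]
  · rw [intervalIntegral.integral_of_le (by norm_num), ← integral_Icc_eq_integral_Ioc] at h
    exact ENNReal.ofReal_le_ofReal h
  · exact (Continuous.continuousOn (by fun_prop)).integrableOn_Icc
  · exact Eventually.of_forall fun _ => sq_nonneg _

theorem IsOutwardNormal.subset_frontier {d : ℕ} {K F : Set (E d)} {n : E d}
    (h : IsOutwardNormal K F n) (hFK : F ⊆ K) : F ⊆ frontier K := by
  obtain ⟨hn, c, hK, hF⟩ := h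
  intro x hx
  refine ⟨subset_closure (hFK hx), fun hxi => ?_⟩
  obtain ⟨ε, hε, hb⟩ := Metric.isOpen_iff.1 isOpen_interior x hxi
  have hmem : x + (ε / 2) • n ∈ Metric.ball x ε := by
    simp [norm_smul, hn, abs_of_pos hε, hε]
  have := hK _ (interior_subset (hb hmem))
  rw [inner_add_right, inner_smul_right, hF x hx, real_inner_self_eq_norm_sq, hn] at this
  linarith

/-- The trace inequality on a flat piece `F` of the boundary of a convex `K` that contains a ball
of radius `ρ`. The apex of the cone over `F` is the centre of the ball, so that its height is at
least `ρ`. -/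
theorem integral_face_polyFun_sq_le {d m : ℕ} {K F : Set (E d)} (hK : Convex ℝ K)
    (hKc : IsCompact K) (hF : MeasurableSet F) (hFK : F ⊆ K) {n : E d}
    (hn : IsOutwardNormal K F n) {x₀ : E d} {ρ : ℝ} (hρ : 0 < ρ)
    (hball : Metric.closedBall x₀ ρ ⊆ K) (A : E d ≃ᵃ[ℝ] E d) {P : MvPolynomial (Fin d) ℝ}
    (hP : P.totalDegree ≤ m) :
    IntegrableOn (fun x => polyFun A P x ^ 2) F (surf d) ∧
    ∫ x in F, polyFun A P x ^ 2 ∂(surf d) ≤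
      4 * (2 * m + 1) ^ 2 * (2 ^ (d - 1) / ρ) * ∫ x in K, polyFun A P x ^ 2 := by
  obtain ⟨hn1, c, hKn, hFn⟩ := hn
  have hcont : Continuous fun x => polyFun A P x ^ 2 := (continuous_polyFun A P).pow 2
  have hc : ρ ≤ c - inner ℝ n x₀ := by
    have hmem : x₀ + ρ • n ∈ Metric.closedBall x₀ ρ := by
      simp [norm_smul, hn1, abs_of_pos hρ]
    have := hKn _ (hball hmem)
    rw [inner_add_right, inner_smul_right, real_inner_self_eq_norm_sq, hn1] at this
    linarith
  have hint : IntegrableOn (fun x => polyFun A P x ^ 2) K :=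
    hcont.continuousOn.integrableOn_compact hKc
  have h := lintegral_face_le hn1 hK hKc.measurableSet (hball (Metric.mem_closedBall_self hρ.le))
    hFK hF hFn hρ hc hcont.measurable.ennreal_ofReal _
    fun y _ => ofReal_sq_polyFun_le A hP x₀ y
  rw [← ofReal_integral_eq_lintegral_ofReal hint (Eventually.of_forall fun _ => sq_nonneg _),
    ← ENNReal.ofReal_mul (by positivity), ← ENNReal.ofReal_mul (by positivity)] at h
  have hintF : IntegrableOn (fun x => polyFun A P x ^ 2) F (surf d) := by
    refine ⟨hcont.aestronglyMeasurable, ?_⟩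
    rw [hasFiniteIntegral_iff_ofReal (Eventually.of_forall fun _ => sq_nonneg _)]
    exact h.trans_lt ENNReal.ofReal_lt_top
  refine ⟨hintF, ?_⟩
  rw [← ofReal_integral_eq_lintegral_ofReal hintF (Eventually.of_forall fun _ => sq_nonneg _)] at h
  exact (ENNReal.ofReal_le_ofReal_iff
    (mul_nonneg (by positivity) (integral_nonneg fun _ => sq_nonneg _))).1 h

/-! ### Traces -/

theorem subset_closure_interior {d : ℕ} {K : Set (E d)} (hK : Convex ℝ K)
    (hKi : (interior K).Nonempty) : K ⊆ closure (interior K) := by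
  rw [hK.closure_interior_eq_closure_of_nonempty_interior hKi]
  exact subset_closure

/-- Almost everywhere equal continuous functions agree on all of `K`, which is the closure of its
interior, so that the choice in the definition of the trace does not matter. -/
theorem eqOn_trace {d : ℕ} {K : Set (E d)} (hK : Convex ℝ K) (hKi : (interior K).Nonempty)
    {u g : E d → ℝ} (hg : ContinuousOn g K) (hu : u =ᵐ[volume.restrict K] g) :
    Set.EqOn (trace K u) g K := by
  have h : ∃ g, ContinuousOn g K ∧ u =ᵐ[volume.restrict K] g := ⟨g, hg, hu⟩
  rw [trace, dif_pos h]
  exact Measure.eqOn_of_ae_eq (h.choose_spec.2.symm.trans hu) h.choose_spec.1 hg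
    (subset_closure_interior hK hKi)

/-- Traces are square integrable on the parts of `∂K` of finite surface measure: a continuous
function is bounded on `K`, and the trace in the sense of Sobolev spaces is in `L²(∂K)`. -/
theorem memLp_trace {d : ℕ} {K F : Set (E d)} (hK : IsCompact K) (hFK : F ⊆ K)
    (hFm : MeasurableSet F) (hFf : F ⊆ frontier K) (hF : surf d F ≠ ⊤) (u : E d → ℝ) :
    MemLp (trace K u) 2 ((surf d).restrict F) := by
  rw [trace]
  split_ifs with h h'
  · have hc := h.choose_spec.1
    obtain ⟨C, hC⟩ := hK.exists_bound_of_continuousOn hc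
    have : IsFiniteMeasure ((surf d).restrict F) := ⟨by simpa using hF.lt_top⟩
    refine MemLp.of_bound ((hc.mono hFK).aestronglyMeasurable hFm) C ?_
    exact (ae_restrict_iff' hFm).2 (Eventually.of_forall fun x hx => hC x (hFK hx))
  · exact h'.choose_spec.1.mono_measure (Measure.restrict_mono hFf le_rfl)
  · exact MemLp.zero

theorem memLp_vtrace {d : ℕ} {K F : Set (E d)} (hK : IsCompact K) (hFK : F ⊆ K)
    (hFm : MeasurableSet F) (hFf : F ⊆ frontier K) (hF : surf d F ≠ ⊤) (v : E d → E d) :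
    MemLp (vtrace K v) 2 ((surf d).restrict F) :=
  memLp_piLp_iff.2 fun i => memLp_trace hK hFK hFm hFf hF fun y => v y i

/-! ### Geometry of the elements and their faces -/

section Cell

variable {d : ℕ} {K : Set (E d)}

theorem convex_cell (hK : IsSimplexCell K ∨ IsBoxCell K) : Convex ℝ K := by
  obtain ⟨S, -, rfl⟩ := cell_eq_convexHull hK
  exact convex_convexHull ℝ S

theorem isCompact_cell (hK : IsSimplexCell K ∨ IsBoxCell K) : IsCompact K := by
  obtain ⟨S, hS, rfl⟩ := cell_eq_convexHull hK
  exact hS.isCompact_convexHull ℝ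

end Cell

/-- Two elements with disjoint interiors are separated by a hyperplane, which contains their
intersection. -/
theorem exists_isOutwardNormal_inter {d : ℕ} {K K' : Set (E d)} (hK : Convex ℝ K)
    (hK' : Convex ℝ K') (hKi : (interior K).Nonempty) (hKi' : (interior K').Nonempty)
    (hd : Disjoint (interior K) (interior K')) : ∃ n, IsOutwardNormal K (K ∩ K') n := by
  obtain ⟨f, u, hf, hf'⟩ :=
    geometric_hahn_banach_open hK.interior isOpen_interior hK'.interior hd
  set n' := (InnerProductSpace.toDual ℝ (E d)).symm f with hn'
  have hfn (x : E d) : f x = inner ℝ n' x := by simp [hn']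
  have hle : ∀ x ∈ K, inner ℝ n' x ≤ u := by
    intro x hx
    rw [← hfn]
    exact closure_minimal (t := {x | f x ≤ u}) (fun y hy => (hf y hy).le)
      (isClosed_le f.continuous continuous_const) (subset_closure_interior hK hKi hx)
  have hge : ∀ x ∈ K', u ≤ inner ℝ n' x := by
    intro x hx
    rw [← hfn]
    exact closure_minimal (t := {x | u ≤ f x}) hf'
      (isClosed_le continuous_const f.continuous) (subset_closure_interior hK' hKi' hx)
  have hn0 : n' ≠ 0 := by
    obtain ⟨a, ha⟩ := hKi
    obtain ⟨b, hb⟩ := hKi'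
    have h := (hf a ha).trans_le (hf' b hb)
    rintro h0
    simp [hfn, h0] at h
  have hpos : 0 < ‖n'‖ := norm_pos_iff.2 hn0
  refine ⟨‖n'‖⁻¹ • n', norm_smul_inv_norm (𝕜 := ℝ) hn0, ‖n'‖⁻¹ * u, fun x hx => ?_, fun x hx => ?_⟩
  · rw [real_inner_smul_left]
    exact mul_le_mul_of_nonneg_left (hle x hx) (by positivity)
  · rw [real_inner_smul_left, le_antisymm (hle x hx.1) (hge x hx.2)]

/-- A set in a convex element with a supporting hyperplane has finite surface measure, since the
constant polynomial `1` satisfies the trace inequality. -/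
theorem surf_ne_top {d : ℕ} {K F : Set (E d)} (hK : Convex ℝ K)
    (hKc : IsCompact K) (hF : MeasurableSet F) (hFK : F ⊆ K) {n : E d}
    (hn : IsOutwardNormal K F n) (hKi : (interior K).Nonempty) : surf d F ≠ ⊤ := by
  obtain ⟨x₀, hx₀⟩ := hKi
  obtain ⟨ρ, hρ, hb⟩ := Metric.nhds_basis_closedBall.mem_iff.1 (mem_interior_iff_mem_nhds.1 hx₀)
  have h := (integral_face_polyFun_sq_le (m := 0) hK hKc hF hFK hn hρ hb (AffineEquiv.refl ℝ _)
    (P := 1) (by simp)).1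
  simp only [polyFun, map_one, one_pow] at h
  rw [integrableOn_const_iff] at h
  simpa using (h.resolve_left (by simp)).ne

namespace Mesh

variable {d : ℕ} {Ω : Set (E d)} {T : Mesh Ω} {σ γ : ℝ} {K F : Set (E d)}

theorem ShapeRegular.interior_nonempty (hT : T.ShapeRegular σ) (hK : K ∈ T.cells) :
    (interior K).Nonempty := by
  obtain ⟨x, ρ, hρ, hb, -⟩ := hT K hK
  exact ⟨x, mem_interior_iff_mem_nhds.2 (mem_of_superset (Metric.closedBall_mem_nhds x hρ) hb)⟩

theorem subset_of_mem_facesOf (hF : F ∈ T.facesOf K) : F ⊆ K := by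
  rcases hF.1 with ⟨K', -, -, rfl⟩ | ⟨G, ⟨n, -, c, -, rfl, -⟩, rfl⟩
  · exact Set.inter_subset_left
  · exact fun x hx => hx.1.1

theorem isCompact_of_mem_facesOf (hK : K ∈ T.cells) (hF : F ∈ T.facesOf K) : IsCompact F := by
  have hKc := isCompact_cell (T.isCell K hK)
  rcases hF.1 with ⟨K', hK', -, rfl⟩ | ⟨G, ⟨n, -, c, -, rfl, -⟩, rfl⟩
  · exact hKc.inter (isCompact_cell (T.isCell K' hK'))
  · refine IsCompact.inter_right ?_ isClosed_frontier
    exact hKc.inter_right (isClosed_eq (by fun_prop) continuous_const)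

theorem isOutwardNormal_normal (hT : T.ShapeRegular σ) (hK : K ∈ T.cells)
    (hF : F ∈ T.facesOf K) : IsOutwardNormal K F (normal K F) := by
  have h : ∃ n, IsOutwardNormal K F n := by
    rcases hF.1 with ⟨K', hK', hne, rfl⟩ | ⟨G, ⟨n, hn, c, hc, rfl, -⟩, rfl⟩
    · exact exists_isOutwardNormal_inter (convex_cell (T.isCell K hK))
        (convex_cell (T.isCell K' hK')) (hT.interior_nonempty hK) (hT.interior_nonempty hK')
        (T.disjoint K hK K' hK' hne.symm)
    · exact ⟨n, hn, c, hc, fun x hx => hx.1.2⟩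
  rw [normal, dif_pos h]
  exact h.choose_spec

theorem memLp_vtrace_face (hT : T.ShapeRegular σ) (hK : K ∈ T.cells) (hF : F ∈ T.facesOf K)
    (v : E d → E d) : MemLp (vtrace K v) 2 ((surf d).restrict F) := by
  have hn := isOutwardNormal_normal hT hK hF
  have hFK := subset_of_mem_facesOf hF
  have hFm := (isCompact_of_mem_facesOf hK hF).measurableSet
  have hKc := isCompact_cell (T.isCell K hK)
  exact memLp_vtrace hKc hFK hFm (hn.subset_frontier hFK)
    (surf_ne_top (convex_cell (T.isCell K hK)) hKc hFm hFK hn (hT.interior_nonempty hK)) v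

theorem diam_pos (hd : 0 < d) (hT : T.ShapeRegular σ) (hK : K ∈ T.cells) :
    0 < Metric.diam K := by
  obtain ⟨x, ρ, hρ, hb, -⟩ := hT K hK
  have : Nonempty (Fin d) := ⟨⟨0, hd⟩⟩
  calc 0 < 2 * ρ := by positivity
    _ = Metric.diam (Metric.closedBall x ρ) := (Metric.diam_closedBall_eq x hρ.le).symm
    _ ≤ Metric.diam K := Metric.diam_mono hb (isCompact_cell (T.isCell K hK)).isBounded

/-- The division by `h_F` in the seminorm is by a positive number. -/
theorem diam_face_pos (hd : 0 < d) (hT : T.ShapeRegular σ) (hT' : T.LocallyQuasiUniform γ)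
    (hK : K ∈ T.cells) (hF : F ∈ T.facesOf K) : 0 < Metric.diam F := by
  rcases Metric.diam_nonneg (s := F) |>.eq_or_lt with h | h
  · have h1 := (hT' K hK F hF).2
    have h2 := diam_pos hd hT hK
    rw [← h, mul_zero] at h1
    exact absurd h1 h2.not_ge
  · exact h

end Mesh

theorem IsPolyOn.exists_polyFun {d : ℕ} {Ω : Set (E d)} {T : Mesh Ω} {K : Set (E d)} {k : ℕ}
    {u : E d → ℝ} (hu : IsPolyOn T K k u) (hd : 0 < d) :
    ∃ P : MvPolynomial (Fin d) ℝ, P.totalDegree ≤ d * k ∧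
      u =ᵐ[volume.restrict K] polyFun (T.coord K) P := by
  obtain ⟨P, hP, hu⟩ := hu
  refine ⟨P, ?_, hu⟩
  rcases hP with ⟨-, hP⟩ | ⟨-, hP⟩
  · exact hP.trans (Nat.le_mul_of_pos_left k hd)
  · refine Finset.sup_le fun s hs => ?_
    calc (s.sum fun _ e => e) = ∑ i, s i := Finsupp.sum_fintype _ _ fun _ => rfl
      _ ≤ ∑ _i : Fin d, k :=
        Finset.sum_le_sum fun i _ => (MvPolynomial.monomial_le_degreeOf i hs).trans (hP i)
      _ = d * k := by simp

/-- The discrete trace inequality on a face of the mesh, with the scaling in the size of the face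
and in the polynomial degree of the seminorm of `𝒰 × 𝒰̂`. -/
theorem integral_face_trace_sq_le {d : ℕ} (hd : 0 < d) {Ω : Set (E d)} {T : Mesh Ω} {σ γ : ℝ}
    (hT : T.ShapeRegular σ) (hT' : T.LocallyQuasiUniform γ) {K F : Set (E d)} (hK : K ∈ T.cells)
    (hF : F ∈ T.facesOf K) {k : ℕ} {u : E d → ℝ} (hu : IsPolyOn T K k u) :
    IntegrableOn (fun x => trace K u x ^ 2) F (surf d) ∧
    Metric.diam F / ((k : ℝ) + 1) ^ 2 * ∫ x in F, trace K u x ^ 2 ∂(surf d) ≤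
      4 * (2 * d + 1) ^ 2 * 2 ^ (d - 1) * σ * ∫ x in K, u x ^ 2 := by
  obtain ⟨P, hP, hu⟩ := hu.exists_polyFun hd
  obtain ⟨x₀, ρ, hρ, hb, hσ⟩ := hT K hK
  have hKv := convex_cell (T.isCell K hK)
  have hFm := (Mesh.isCompact_of_mem_facesOf hK hF).measurableSet
  have hFK := Mesh.subset_of_mem_facesOf hF
  have htr : Set.EqOn (fun x => trace K u x ^ 2) (fun x => polyFun (T.coord K) P x ^ 2) F :=
    fun x hx => congrArg (· ^ 2) (eqOn_trace hKv (hT.interior_nonempty hK)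
      (continuous_polyFun _ _).continuousOn hu (hFK hx))
  obtain ⟨hi, hle⟩ := integral_face_polyFun_sq_le hKv (isCompact_cell (T.isCell K hK)) hFm hFK
    (Mesh.isOutwardNormal_normal hT hK hF) hρ hb (T.coord K) hP
  refine ⟨hi.congr_fun htr.symm hFm, ?_⟩
  have hu2 : (fun x => u x ^ 2) =ᵐ[volume.restrict K] fun x => polyFun (T.coord K) P x ^ 2 :=
    hu.fun_comp (· ^ 2)
  rw [setIntegral_congr_fun hFm htr, integral_congr_ae hu2]
  have hI : 0 ≤ ∫ x in K, polyFun (T.coord K) P x ^ 2 := integral_nonneg fun _ => sq_nonneg _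
  set I := ∫ x in K, polyFun (T.coord K) P x ^ 2
  set S := ∫ x in F, polyFun (T.coord K) P x ^ 2 ∂(surf d)
  have hdiam : Metric.diam F ≤ σ * ρ := ((hT' K hK F hF).1).trans hσ
  have hk : (2 * ((d * k : ℕ) : ℝ) + 1) ^ 2 ≤ (2 * d + 1) ^ 2 * ((k : ℝ) + 1) ^ 2 := by
    rw [← mul_pow]
    push_cast
    have : (0 : ℝ) ≤ d := by positivity
    have : (0 : ℝ) ≤ k := by positivity
    refine pow_le_pow_left₀ (by positivity) ?_ 2
    nlinarith
  calc Metric.diam F / ((k : ℝ) + 1) ^ 2 * S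
      ≤ Metric.diam F / ((k : ℝ) + 1) ^ 2 *
        (4 * ((2 * d + 1) ^ 2 * ((k : ℝ) + 1) ^ 2) * (2 ^ (d - 1) / ρ) * I) := by
        have := Metric.diam_nonneg (s := F)
        refine mul_le_mul_of_nonneg_left (hle.trans ?_) (by positivity)
        gcongr
    _ = 4 * (2 * d + 1) ^ 2 * 2 ^ (d - 1) * (Metric.diam F / ρ) * I := by
        field_simp
    _ ≤ 4 * (2 * d + 1) ^ 2 * 2 ^ (d - 1) * σ * I := by
        gcongr
        rwa [div_le_iff₀ hρ]

/-! ### The number of faces of an element -/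

theorem ncard_pair_le {α : Type*} (a b : α) : ({a, b} : Set α).ncard ≤ 2 :=
  (Set.ncard_insert_le a {b}).trans (by simp)

theorem cell_eq_convexHull_ncard {d : ℕ} (hd : d ≤ 3) {K : Set (E d)}
    (hK : IsSimplexCell K ∨ IsBoxCell K) :
    ∃ S : Set (E d), S.Finite ∧ S.ncard ≤ 8 ∧ K = convexHull ℝ S := by
  have hrange {m : ℕ} (hm : m ≤ 8) (p : Fin m → E d) : (Set.range p).ncard ≤ 8 := by
    rw [← Set.image_univ]
    exact (Set.ncard_image_le Set.finite_univ).trans (by simpa [Set.ncard_univ] using hm)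
  rcases hK with ⟨p, -, h⟩ | ⟨-, p, -, h⟩ | ⟨rfl, a, e, -, h⟩
  · exact ⟨_, Set.finite_range p, hrange (by omega) p, h⟩
  · exact ⟨_, Set.finite_range p, hrange (by omega) p, h⟩
  · have hfin : (∑ i, ({0, e i} : Set (E 3))).Finite :=
      Finset.sum_induction _ Set.Finite (fun _ _ ha hb => ha.add hb)
        (Set.finite_singleton 0) fun i _ => Set.toFinite _
    refine ⟨a +ᵥ ∑ i, ({0, e i} : Set (E 3)), hfin.vadd_set, ?_, ?_⟩
    · have hadd (s t : Set (E 3)) : (s + t).ncard ≤ s.ncard * t.ncard := Set.natCard_add_le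
      refine (Set.ncard_image_le hfin).trans ?_
      rw [Fin.sum_univ_three]
      calc _ ≤ 2 * 2 * 2 := (hadd _ _).trans
            (Nat.mul_le_mul ((hadd _ _).trans
              (Nat.mul_le_mul (ncard_pair_le _ _) (ncard_pair_le _ _))) (ncard_pair_le _ _))
        _ = 8 := rfl
    · rw [h, parallelepiped_eq_convexHull, convexHull_vadd]

/-- A side of a polytope is determined by the vertices on it, so that an element has at most `2⁸`
sides. -/
theorem ncard_facets_le {d : ℕ} (hd : d ≤ 3) {K : Set (E d)}
    (hK : IsSimplexCell K ∨ IsBoxCell K) : {G | IsFacet K G}.ncard ≤ 256 := by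
  obtain ⟨S, hS, hS8, hKS⟩ := cell_eq_convexHull_ncard hd hK
  have hcomp := isCompact_cell hK
  have hconv := convex_cell hK
  have key : ∀ G ∈ {G | IsFacet K G}, IsExposed ℝ K G := by
    rintro G ⟨n, -, c, hc, rfl, -⟩ ⟨y, hy⟩
    refine ⟨innerSL ℝ n, Set.ext fun x => ?_⟩
    simp only [Set.mem_ofPred_eq, innerSL_apply_apply]
    exact ⟨fun hx => ⟨hx.1, fun z hz => hx.2 ▸ hc z hz⟩,
      fun hx => ⟨hx.1, le_antisymm (hc x hx.1) (hy.2 ▸ hx.2 y hy.1)⟩⟩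
  calc {G | IsFacet K G}.ncard ≤ (𝒫 S).ncard := by
        refine Set.ncard_le_ncard_of_injOn (fun G => Set.extremePoints ℝ G) ?_ ?_ hS.finite_subsets
        · intro G hG
          refine ((key G hG).isExtreme.extremePoints_subset_extremePoints).trans ?_
          rw [hKS]
          exact extremePoints_convexHull_subset
        · intro G hG G' hG' h
          rw [← closure_convexHull_extremePoints ((key G hG).isCompact hcomp)
              ((key G hG).convex hconv),
            ← closure_convexHull_extremePoints ((key G' hG').isCompact hcomp)
              ((key G' hG').convex hconv)]
          exact congrArg (fun A => closure (convexHull ℝ A)) h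
    _ = 2 ^ S.ncard := Set.ncard_powerset S hS
    _ ≤ 2 ^ 8 := Nat.pow_le_pow_right (by norm_num) hS8
    _ = 256 := rfl

/-- A packing bound: finitely many disjoint balls of radius `r` in a ball of radius `R`. -/
theorem card_mul_pow_le_of_disjoint_balls {d : ℕ} {ι : Type*} (s : Finset ι) (c : ι → E d)
    {x : E d} {r R : ℝ} (hr : 0 < r) (hR : 0 ≤ R)
    (hd : Set.PairwiseDisjoint (s : Set ι) fun i => Metric.ball (c i) r)
    (hsub : ∀ i ∈ s, Metric.ball (c i) r ⊆ Metric.closedBall x R) :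
    (s.card : ℝ) * r ^ d ≤ R ^ d := by
  have h1 : volume (⋃ i ∈ s, Metric.ball (c i) r) ≤ volume (Metric.closedBall x R) :=
    measure_mono (Set.iUnion₂_subset hsub)
  rw [measure_biUnion_finset hd fun i _ => measurableSet_ball,
    Measure.addHaar_closedBall _ _ hR,
    Finset.sum_congr rfl fun i _ => Measure.addHaar_ball_of_pos volume (c i) hr,
    Finset.sum_const, nsmul_eq_mul, ← mul_assoc, finrank_euclideanSpace_fin,
    ENNReal.mul_le_mul_iff_left (Metric.measure_ball_pos volume _ one_pos).ne'
      measure_ball_lt_top.ne, ← ENNReal.ofReal_natCast,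
    ← ENNReal.ofReal_mul (by positivity), ENNReal.ofReal_le_ofReal_iff (by positivity)] at h1
  exact h1

namespace Mesh

variable {d : ℕ} {Ω : Set (E d)} {T : Mesh Ω} {σ γ : ℝ} {K : Set (E d)}

/-- Neighbours of an element across a face have comparable size, so that they contain disjoint
balls of comparable radius in a comparable neighbourhood of it. -/
theorem card_neighbours_le (hd : 0 < d) (hT : T.ShapeRegular σ) (hT' : T.LocallyQuasiUniform γ)
    (hK : K ∈ T.cells) (s : Finset (Set (E d)))
    (hs : ∀ K' ∈ s, K' ∈ T.cells ∧ K' ≠ K ∧ K ∩ K' ∈ T.facesOf K) :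
    (s.card : ℝ) ≤ |(γ + 1) * (γ * σ)| ^ d := by
  rcases s.eq_empty_or_nonempty with rfl | ⟨K₁, hK₁⟩
  · simp only [Finset.card_empty, Nat.cast_zero]; positivity
  have hh := diam_pos hd hT hK
  set h := Metric.diam K
  have hγ : 0 < γ := by
    obtain ⟨-, -, hF⟩ := hs K₁ hK₁
    have h1 := hh.trans_le (hT' K hK _ hF).2
    exact pos_of_mul_pos_left h1 Metric.diam_nonneg
  have hσ : 0 < σ := by
    obtain ⟨x, ρ, hρ, -, h1⟩ := hT K hK
    exact pos_of_mul_pos_left (hh.trans_le h1) hρ.le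
  set r := h / (γ * σ) with hr
  have hr0 : 0 < r := by positivity
  have hball : ∀ K' ∈ s, ∃ c, Metric.ball c r ⊆ K' := by
    intro K' hK'
    obtain ⟨hKc, hne, hF⟩ := hs K' hK'
    have hF' : K ∩ K' ∈ T.facesOf K' :=
      ⟨Or.inl ⟨K, hK, hne.symm, Set.inter_comm _ _⟩, hF.2⟩
    obtain ⟨c, ρ, hρ, hb, hc⟩ := hT K' hKc
    refine ⟨c, (Metric.ball_subset_closedBall.trans
      (Metric.closedBall_subset_closedBall ?_)).trans hb⟩
    rw [hr, div_le_iff₀ (by positivity)]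
    calc h ≤ γ * Metric.diam (K ∩ K') := (hT' K hK _ hF).2
      _ ≤ γ * Metric.diam K' := by gcongr; exact (hT' K' hKc _ hF').1
      _ ≤ γ * (σ * ρ) := by gcongr
      _ = ρ * (γ * σ) := by ring
  choose! c hc using hball
  obtain ⟨x, hx⟩ := (hT.interior_nonempty hK).mono interior_subset
  have hpack := card_mul_pow_le_of_disjoint_balls s c (x := x) (R := (γ + 1) * h) hr0
    (by positivity) ?_ ?_
  · calc (s.card : ℝ) ≤ ((γ + 1) * h) ^ d / r ^ d := by rwa [le_div_iff₀ (by positivity)]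
      _ = ((γ + 1) * (γ * σ)) ^ d := by
        rw [← div_pow, hr]; congr 1; field_simp
      _ ≤ |(γ + 1) * (γ * σ)| ^ d := by
        gcongr; exact le_abs_self _
  · intro K' hK' K'' hK'' hne
    have hi : ∀ L ∈ s, Metric.ball (c L) r ⊆ interior L := fun L hL =>
      interior_maximal (hc L hL) Metric.isOpen_ball
    exact (T.disjoint K' (hs K' hK').1 K'' (hs K'' hK'').1 hne).mono (hi K' hK') (hi K'' hK'')
  · intro K' hK' y hy
    obtain ⟨hKc, hne, hF⟩ := hs K' hK'
    have hF' : K ∩ K' ∈ T.facesOf K' :=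
      ⟨Or.inl ⟨K, hK, hne.symm, Set.inter_comm _ _⟩, hF.2⟩
    obtain ⟨z, hz⟩ : (K ∩ K').Nonempty := by
      by_contra hempty
      rw [Set.not_nonempty_iff_eq_empty] at hempty
      simpa [hempty] using hF.2
    have h1 : dist y z ≤ Metric.diam K' :=
      Metric.dist_le_diam_of_mem (isCompact_cell (T.isCell K' hKc)).isBounded (hc K' hK' hy) hz.2
    have h2 : dist z x ≤ h :=
      Metric.dist_le_diam_of_mem (isCompact_cell (T.isCell K hK)).isBounded hz.1 hx
    have h3 : Metric.diam K' ≤ γ * h := (hT' K' hKc _ hF').2.trans <| by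
      gcongr
      exact (hT' K hK _ hF).1
    rw [Metric.mem_closedBall]
    linarith [dist_triangle y z x]

theorem ncard_facesOf_le (hd : 0 < d) (hd3 : d ≤ 3) (hT : T.ShapeRegular σ)
    (hT' : T.LocallyQuasiUniform γ) (hK : K ∈ T.cells) :
    ((T.facesOf K).ncard : ℝ) ≤ |(γ + 1) * (γ * σ)| ^ d + 256 := by
  classical
  set s := T.cells.filter fun K' => K' ≠ K ∧ K ∩ K' ∈ T.facesOf K with hs
  have hfac := finite_facets (T.isCell K hK)
  have hsub : T.facesOf K ⊆ ((fun K' => K ∩ K') '' (s : Set (Set (E d)))) ∪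
      ((fun G => G ∩ frontier Ω) '' {G | IsFacet K G}) := by
    intro F hF
    rcases hF.1 with ⟨K', hK', hne, rfl⟩ | ⟨G, hG, rfl⟩
    · exact Or.inl ⟨K', by simp [hs, hK', hne, hF], rfl⟩
    · exact Or.inr ⟨G, hG, rfl⟩
  have h1 : (T.facesOf K).ncard ≤ s.card + 256 :=
    calc _ ≤ _ := Set.ncard_le_ncard hsub ((s.finite_toSet.image _).union (hfac.image _))
      _ ≤ _ := Set.ncard_union_le _ _
      _ ≤ s.card + 256 := add_le_add
        ((Set.ncard_image_le s.finite_toSet).trans (Set.ncard_coe_finset s).le)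
        ((Set.ncard_image_le hfac).trans (ncard_facets_le hd3 (T.isCell K hK)))
  have h2 := card_neighbours_le hd hT hT' hK s fun K' hK' => Finset.mem_filter.1 hK'
  have h3 : ((T.facesOf K).ncard : ℝ) ≤ s.card + 256 := by exact_mod_cast h1
  linarith

end Mesh

/-! ### The elements and the domain -/

/-- A Lipschitz domain lies on one side of its boundary: below the graph there are no points of
the closure. -/
theorem IsLipschitzDomain.interior_closure_subset {d : ℕ} {Ω : Set (E d)}
    (hΩ : IsLipschitzDomain Ω) : interior (closure Ω) ⊆ Ω := by
  intro x hx
  by_contra hxΩ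
  have hfr : x ∈ frontier Ω := ⟨interior_subset hx, by rwa [hΩ.isOpen.interior_eq]⟩
  obtain ⟨e, g, L, ε, he, hg, hge, hε, hgraph⟩ := hΩ.graph x hfr
  have hxg : inner ℝ x e ≤ g x := by
    by_contra! h
    exact hxΩ ((hgraph x (Metric.mem_ball_self hε)).2 h)
  set W := Metric.ball x ε ∩ interior (closure Ω)
  have hW : IsOpen W := Metric.isOpen_ball.inter isOpen_interior
  obtain ⟨δ, hδ, hb⟩ := Metric.isOpen_iff.1 hW x ⟨Metric.mem_ball_self hε, hx⟩
  set y := x + (-(δ / 2)) • e with hy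
  have hyW : y ∈ W := hb (by simp [hy, norm_smul, he, abs_of_pos hδ, hδ])
  have hyV : inner ℝ y e < g y := by
    rw [hy, hge, inner_add_left, real_inner_smul_left, real_inner_self_eq_norm_sq, he]
    linarith
  have hV : IsOpen (W ∩ {y | inner ℝ y e < g y}) :=
    hW.inter (isOpen_lt (by fun_prop) hg.continuous)
  obtain ⟨z, ⟨hzW, hz⟩, hzΩ⟩ :=
    mem_closure_iff.1 (interior_subset hyW.2) _ hV ⟨hyW, hyV⟩
  exact absurd ((hgraph z hzW.1).1 hzΩ) hz.not_gt

namespace Mesh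

variable {d : ℕ} {Ω : Set (E d)} {T : Mesh Ω} {K : Set (E d)}

theorem interior_subset_domain (hΩ : IsLipschitzDomain Ω) (hK : K ∈ T.cells) :
    interior K ⊆ Ω := by
  refine (interior_mono ?_).trans hΩ.interior_closure_subset
  rw [← T.cover]
  exact Set.subset_biUnion_of_mem (u := fun K : Set (E d) => K) hK

theorem interior_ae_eq (hK : K ∈ T.cells) : interior K =ᵐ[volume] K :=
  interior_ae_eq_of_null_frontier ((convex_cell (T.isCell K hK)).addHaar_frontier volume)

theorem restrict_le (hΩ : IsLipschitzDomain Ω) (hK : K ∈ T.cells) :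
    (volume : Measure (E d)).restrict K ≤ volume.restrict Ω := by
  rw [← Measure.restrict_congr_set (interior_ae_eq hK)]
  exact Measure.restrict_mono (interior_subset_domain hΩ hK) le_rfl

theorem sum_integral_cells_le (hΩ : IsLipschitzDomain Ω) {f : E d → ℝ} (hf : IntegrableOn f Ω)
    (hf0 : ∀ x, 0 ≤ f x) : ∑ K ∈ T.cells, ∫ x in K, f x ≤ ∫ x in Ω, f x := by
  have hsub : ⋃ K ∈ T.cells, interior K ⊆ Ω :=
    Set.iUnion₂_subset fun K hK => interior_subset_domain hΩ hK
  calc ∑ K ∈ T.cells, ∫ x in K, f x = ∑ K ∈ T.cells, ∫ x in interior K, f x :=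
        Finset.sum_congr rfl fun K hK => (setIntegral_congr_set (interior_ae_eq hK)).symm
    _ = ∫ x in ⋃ K ∈ T.cells, interior K, f x :=
        (integral_biUnion_finset _ (fun K _ => isOpen_interior.measurableSet)
          (fun K hK K' hK' hne => T.disjoint K hK K' hK' hne)
          fun K hK => hf.mono_set (interior_subset_domain hΩ hK)).symm
    _ ≤ ∫ x in Ω, f x :=
        setIntegral_mono_set hf (Eventually.of_forall hf0) hsub.eventuallyLE

end Mesh

/-! ### Coercivity of the material norm -/

section Frob

variable {d : ℕ}

theorem frob_sub_smul_left (A B C : Matrix (Fin d) (Fin d) ℝ) (t : ℝ) :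
    frob (A - t • B) C = frob A C - t * frob B C := by
  simp [frob, sub_mul, Finset.sum_sub_distrib, Finset.mul_sum, mul_assoc]

theorem frob_comm (A B : Matrix (Fin d) (Fin d) ℝ) : frob A B = frob B A := by
  simp [frob, mul_comm]

theorem frob_sub_smul_right (A B C : Matrix (Fin d) (Fin d) ℝ) (t : ℝ) :
    frob C (A - t • B) = frob C A - t * frob C B := by
  rw [frob_comm, frob_sub_smul_left, frob_comm A, frob_comm B]

theorem frob_self (A : Matrix (Fin d) (Fin d) ℝ) : frob A A = ∑ i, ∑ j, A i j ^ 2 := by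
  simp [frob, sq]

end Frob

/-- The compliance tensor is bounded below by the reciprocal of an upper bound `c` of the
elasticity tensor: expand `0 ≤ 𝒞ξ : ξ` at `ξ = 𝒜ζ - c⁻¹ ζ`. -/
theorem Material.exists_frob_self_le {d : ℕ} (M : Material d) :
    ∃ c : ℝ, 0 < c ∧ ∀ ζ : symMat d, frob ζ.1 ζ.1 ≤ c * frob (M.compliance ζ).1 ζ.1 := by
  obtain ⟨cm, cp, hcm, hcp, h⟩ := M.elasticity_bounds
  have hcp0 : 0 < cp := hcm.trans hcp
  refine ⟨cp, hcp0, fun ζ => ?_⟩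
  set ξ := M.compliance ζ
  have hξ : M.elasticity ξ = ζ :=
    (LinearEquiv.ofInjectiveEndo M.elasticity M.elasticity_injective).apply_symm_apply ζ
  have hsymm := M.elasticity_symm ζ ξ
  rw [hξ] at hsymm
  have hub := (h ζ).2
  have hpos : 0 ≤ frob (M.elasticity (ξ - cp⁻¹ • ζ)).1 (ξ - cp⁻¹ • ζ).1 :=
    (mul_nonneg hcm.le (frob_self_nonneg _)).trans (h _).1
  rw [map_sub, map_smul, hξ] at hpos
  change 0 ≤ frob (ζ.1 - cp⁻¹ • (M.elasticity ζ).1) (ξ.1 - cp⁻¹ • ζ.1) at hpos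
  rw [frob_sub_smul_left, frob_sub_smul_right, frob_sub_smul_right, hsymm, frob_comm ζ.1 ξ.1] at hpos
  have h1 : cp⁻¹ * (cp⁻¹ * frob (M.elasticity ζ).1 ζ.1) ≤ cp⁻¹ * frob ζ.1 ζ.1 := by
    gcongr
    rwa [inv_mul_le_iff₀ hcp0]
  have h2 : cp⁻¹ * frob ζ.1 ζ.1 ≤ frob ξ.1 ζ.1 := by linarith
  rwa [inv_mul_le_iff₀ hcp0] at h2

/-- The least eigenvalue of `Q` is at least `det Q / tr Q`. -/
theorem Material.Q_coercive {d : ℕ} (M : Material d) (z φ : ℝ) :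
    (M.a₀ * M.c₀ - M.b₀ ^ 2) / (M.a₀ + M.c₀) * (z ^ 2 + φ ^ 2) ≤
      (M.c₀ * z - M.b₀ * φ) * z + (-M.b₀ * z + M.a₀ * φ) * φ := by
  have ha := M.a₀_pos
  have hc := M.c₀_pos
  rw [div_mul_eq_mul_div, div_le_iff₀ (by positivity)]
  nlinarith [sq_nonneg (M.c₀ * z - M.b₀ * φ), sq_nonneg (M.a₀ * φ - M.b₀ * z)]

/-- A linear map on symmetric matrices, in coordinates; the coefficients come from an extension to
all matrices. -/
theorem exists_coeff {d : ℕ} (L : symMat d →ₗ[ℝ] symMat d) :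
    ∃ c : Fin d → Fin d → Fin d → Fin d → ℝ, ∀ A : symMat d, ∀ i j,
      (L A).1 i j = ∑ k, ∑ l, A.1 k l * c i j k l := by
  obtain ⟨g, hg⟩ := LinearMap.exists_extend ((symMat d).subtype ∘ₗ L)
  refine ⟨fun i j k l => g (Matrix.single k l 1) i j, fun A i j => ?_⟩
  have h : (L A).1 = g A.1 := (LinearMap.congr_fun hg A).symm
  rw [h]
  conv_lhs => rw [Matrix.matrix_eq_sum_single A.1]
  simp only [map_sum, Matrix.sum_apply]
  refine Finset.sum_congr rfl fun k _ => Finset.sum_congr rfl fun l _ => ?_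
  have : Matrix.single k l (A.1 k l) = A.1 k l • Matrix.single k l (1 : ℝ) := by simp
  rw [this, map_smul, Matrix.smul_apply, smul_eq_mul]

/-- The squared Euclidean length of a stress, a pressure and a temperature. -/
def energy {d : ℕ} (A : Matrix (Fin d) (Fin d) ℝ) (z φ : ℝ) : ℝ := frob A A + z ^ 2 + φ ^ 2

theorem energy_nonneg {d : ℕ} (A : Matrix (Fin d) (Fin d) ℝ) (z φ : ℝ) : 0 ≤ energy A z φ :=
  add_nonneg (add_nonneg (frob_self_nonneg A) (sq_nonneg z)) (sq_nonneg φ)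

theorem integrable_frob_self {d : ℕ} {α : Type*} [MeasurableSpace α] {μ : Measure α}
    {A : α → Matrix (Fin d) (Fin d) ℝ} (hA : ∀ i j, Integrable (fun x => A x i j ^ 2) μ) :
    Integrable (fun x => frob (A x) (A x)) μ := by
  simp only [frob_self]
  exact integrable_finsetSum _ fun i _ => integrable_finsetSum _ fun j _ => hA i j

theorem integrable_energy {d : ℕ} {α : Type*} [MeasurableSpace α] {μ : Measure α}
    {A : α → Matrix (Fin d) (Fin d) ℝ} {z φ : α → ℝ}
    (hA : ∀ i j, Integrable (fun x => A x i j ^ 2) μ) (hz : Integrable (fun x => z x ^ 2) μ)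
    (hφ : Integrable (fun x => φ x ^ 2) μ) :
    Integrable (fun x => energy (A x) (z x) (φ x)) μ :=
  ((integrable_frob_self hA).add hz).add hφ

theorem integral_energy {d : ℕ} {α : Type*} [MeasurableSpace α] {μ : Measure α}
    {A : α → Matrix (Fin d) (Fin d) ℝ} {z φ : α → ℝ}
    (hA : ∀ i j, Integrable (fun x => A x i j ^ 2) μ) (hz : Integrable (fun x => z x ^ 2) μ)
    (hφ : Integrable (fun x => φ x ^ 2) μ) :
    ∫ x, energy (A x) (z x) (φ x) ∂μ =
      (∑ i, ∑ j, ∫ x, A x i j ^ 2 ∂μ) + ∫ x, z x ^ 2 ∂μ + ∫ x, φ x ^ 2 ∂μ := by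
  have hF := integrable_frob_self hA
  simp only [energy]
  rw [integral_add (by exact hF.add hz) hφ, integral_add hF hz]
  congr 2
  simp only [frob_self]
  rw [integral_finsetSum _ fun i _ => integrable_finsetSum _ fun j _ => hA i j]
  exact Finset.sum_congr rfl fun i _ => integral_finsetSum _ fun j _ => hA i j

/-- The norm of `ℋ₂` controls the `L²` norm. -/
theorem exists_integral_energy_le {d : ℕ} (Ω : Set (E d)) (M : Material d) :
    ∃ c : ℝ, 0 < c ∧ ∀ Φ : State d,
      (∀ i j, MemLp (fun x => (Φ.τ x).1 i j) 2 (volume.restrict Ω)) →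
      MemLp Φ.z 2 (volume.restrict Ω) → MemLp Φ.φ 2 (volume.restrict Ω) →
      ∫ x in Ω, energy (Φ.τ x).1 (Φ.z x) (Φ.φ x) ≤ c * H2norm Ω M Φ ^ 2 := by
  obtain ⟨c₁, hc₁, h₁⟩ := M.exists_frob_self_le
  obtain ⟨a, ha⟩ := exists_coeff M.compliance.toLinearMap
  set q := (M.a₀ * M.c₀ - M.b₀ ^ 2) / (M.a₀ + M.c₀)
  have hq : 0 < q := div_pos M.det_pos (add_pos M.a₀_pos M.c₀_pos)
  refine ⟨c₁ + q⁻¹, by positivity, fun Φ hτ hz hφ => ?_⟩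
  have hi1 : IntegrableOn (fun x => frob (M.compliance (Φ.τ x)).1 (Φ.τ x).1) Ω := by
    have (x : E d) (i j : Fin d) : (M.compliance (Φ.τ x)).1 i j = _ := ha (Φ.τ x) i j
    simp only [frob, this, Finset.sum_mul]
    refine integrable_finsetSum _ fun i _ => integrable_finsetSum _ fun j _ =>
      integrable_finsetSum _ fun k _ => integrable_finsetSum _ fun l _ => ?_
    exact ((hτ k l).mul_const (a i j k l)).integrable_mul (hτ i j)
  have hi2 : IntegrableOn (fun x => (M.c₀ * Φ.z x - M.b₀ * Φ.φ x) * Φ.z x +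
      (-M.b₀ * Φ.z x + M.a₀ * Φ.φ x) * Φ.φ x) Ω :=
    ((((hz.const_mul M.c₀).sub (hφ.const_mul M.b₀)).integrable_mul hz).add
      (((hz.const_mul (-M.b₀)).add (hφ.const_mul M.a₀)).integrable_mul hφ))
  have hfr (x : E d) : 0 ≤ frob (M.compliance (Φ.τ x)).1 (Φ.τ x).1 :=
    nonneg_of_mul_nonneg_right ((frob_self_nonneg _).trans (h₁ (Φ.τ x))) hc₁
  have hQ (x : E d) : 0 ≤ (M.c₀ * Φ.z x - M.b₀ * Φ.φ x) * Φ.z x +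
      (-M.b₀ * Φ.z x + M.a₀ * Φ.φ x) * Φ.φ x :=
    le_trans (by positivity) (M.Q_coercive (Φ.z x) (Φ.φ x))
  rw [H2norm, Real.sq_sqrt (add_nonneg (integral_nonneg hfr) (integral_nonneg hQ)),
    ← integral_add hi1 hi2, ← integral_const_mul]
  refine integral_mono (integrable_energy (fun i j => (hτ i j).integrable_sq) hz.integrable_sq
    hφ.integrable_sq) ((hi1.add hi2).const_mul _) fun x => ?_
  have e1 := h₁ (Φ.τ x)
  have e2 : Φ.z x ^ 2 + Φ.φ x ^ 2 ≤ q⁻¹ * _ :=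
    (le_inv_mul_iff₀ hq).2 (M.Q_coercive (Φ.z x) (Φ.φ x))
  have e3 := mul_nonneg (inv_nonneg.2 hq.le) (hfr x)
  have e4 := mul_nonneg hc₁.le (hQ x)
  simp only [energy]
  linarith

/-! ### Young's inequality for the terms of the bilinear form -/

theorem abs_mul_le_young {t : ℝ} (ht : 0 < t) (a b : ℝ) :
    |a * b| ≤ t * a ^ 2 + t⁻¹ * b ^ 2 := by
  have h1 : 0 ≤ t⁻¹ * (t * a + b) ^ 2 := by positivity
  have h2 : 0 ≤ t⁻¹ * (t * a - b) ^ 2 := by positivity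
  have h3 : 0 ≤ t * a ^ 2 := by positivity
  have h4 : 0 ≤ t⁻¹ * b ^ 2 := by positivity
  have e1 : t⁻¹ * (t * a + b) ^ 2 = t * a ^ 2 + 2 * (a * b) + t⁻¹ * b ^ 2 := by
    field_simp; ring
  have e2 : t⁻¹ * (t * a - b) ^ 2 = t * a ^ 2 - 2 * (a * b) + t⁻¹ * b ^ 2 := by
    field_simp; ring
  rw [abs_le]
  constructor <;> linarith

theorem abs_frob_le_young {d : ℕ} {t : ℝ} (ht : 0 < t) (A B : Matrix (Fin d) (Fin d) ℝ) :
    |frob A B| ≤ t * frob A A + t⁻¹ * frob B B := by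
  rw [frob_self, frob_self, frob, Finset.mul_sum, Finset.mul_sum, ← Finset.sum_add_distrib]
  refine (Finset.abs_sum_le_sum_abs _ _).trans (Finset.sum_le_sum fun i _ => ?_)
  rw [Finset.mul_sum, Finset.mul_sum, ← Finset.sum_add_distrib]
  exact (Finset.abs_sum_le_sum_abs _ _).trans
    (Finset.sum_le_sum fun j _ => abs_mul_le_young ht _ _)

theorem abs_inner_le_young {d : ℕ} {t : ℝ} (ht : 0 < t) (a b : E d) :
    |inner ℝ a b| ≤ t * ‖a‖ ^ 2 + t⁻¹ * ‖b‖ ^ 2 :=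
  (abs_real_inner_le_norm a b).trans ((le_abs_self _).trans (abs_mul_le_young ht _ _))

theorem norm_mulVec_sq_le {d : ℕ} (A : Matrix (Fin d) (Fin d) ℝ) {n : E d} (hn : ‖n‖ = 1) :
    ‖(WithLp.toLp 2 (A.mulVec n) : E d)‖ ^ 2 ≤ frob A A := by
  rw [EuclideanSpace.norm_sq_eq, frob_self]
  refine Finset.sum_le_sum fun i _ => ?_
  have h := Finset.sum_mul_sq_le_sq_mul_sq Finset.univ (fun j => A i j) fun j => n j
  have hn2 : ∑ j, n j ^ 2 = 1 := by
    rw [← EuclideanSpace.real_norm_sq_eq, hn, one_pow]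
  rw [hn2, mul_one] at h
  simpa [Matrix.mulVec, dotProduct] using h

/-- The constant in the bound of the total stress by the energy. -/
def Material.stressConst {d : ℕ} (M : Material d) : ℝ := 2 + 4 * d * (M.α ^ 2 + M.β ^ 2)

theorem Material.stressConst_pos {d : ℕ} (M : Material d) : 0 < M.stressConst := by
  unfold Material.stressConst; positivity

theorem frob_totalStress_le {d : ℕ} (M : Material d) (A : Matrix (Fin d) (Fin d) ℝ) (z φ : ℝ) :
    frob (totalStress M A z φ) (totalStress M A z φ) ≤ M.stressConst * energy A z φ := by
  set p := M.α * z + M.β * φ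
  have hp : p ^ 2 ≤ 2 * (M.α ^ 2 + M.β ^ 2) * (z ^ 2 + φ ^ 2) := by
    nlinarith [sq_nonneg (M.α * z - M.β * φ), sq_nonneg (M.α * φ), sq_nonneg (M.β * z)]
  have h1 : frob (totalStress M A z φ) (totalStress M A z φ) ≤ 2 * frob A A + 2 * (d * p ^ 2) := by
    have hI : ∑ i : Fin d, ∑ j : Fin d, p ^ 2 * (1 : Matrix (Fin d) (Fin d) ℝ) i j = d * p ^ 2 := by
      simp [Matrix.one_apply]
    rw [← hI, frob_self, frob_self, Finset.mul_sum, Finset.mul_sum, ← Finset.sum_add_distrib]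
    refine Finset.sum_le_sum fun i _ => ?_
    rw [Finset.mul_sum, Finset.mul_sum, ← Finset.sum_add_distrib]
    refine Finset.sum_le_sum fun j _ => ?_
    simp only [totalStress, Matrix.sub_apply, Matrix.smul_apply, smul_eq_mul, Matrix.one_apply]
    split_ifs
    · nlinarith [sq_nonneg (A i j + p)]
    · nlinarith [sq_nonneg (A i j)]
  have h2 : (d : ℝ) * p ^ 2 ≤ d * (2 * (M.α ^ 2 + M.β ^ 2) * (z ^ 2 + φ ^ 2)) := by gcongr
  have h3 : 0 ≤ 4 * d * (M.α ^ 2 + M.β ^ 2) * frob A A :=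
    mul_nonneg (by positivity) (frob_self_nonneg A)
  have h4 := sq_nonneg z
  have h5 := sq_nonneg φ
  unfold Material.stressConst energy
  nlinarith

theorem abs_integral_le_young {α : Type*} [MeasurableSpace α] {μ : Measure α} {f p q : α → ℝ}
    {s t : ℝ} (hp : Integrable p μ) (hq : Integrable q μ)
    (h : ∀ x, |f x| ≤ s * p x + t * q x) :
    |∫ x, f x ∂μ| ≤ s * ∫ x, p x ∂μ + t * ∫ x, q x ∂μ := by
  rw [← integral_const_mul, ← integral_const_mul,
    ← integral_add (hp.const_mul s) (hq.const_mul t)]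
  exact norm_integral_le_of_norm_le (f := f) (g := fun x => s * p x + t * q x)
    ((hp.const_mul s).add (hq.const_mul t)) (Eventually.of_forall h)

/-- Optimization over the parameter in Young's inequality. -/
theorem le_two_mul_sqrt_mul_sqrt {x A D : ℝ}
    (h : ∀ t : ℝ, 0 < t → x ≤ t * A + t⁻¹ * D) : x ≤ 2 * (√A * √D) := by
  -- the optimal parameter is `√D / √A`; larger `a` and `b` avoid division by zero
  have key : ∀ a b : ℝ, √A < a → √D < b → x ≤ 2 * (a * b) := by
    intro a b ha hb
    have ha0 : 0 < a := (Real.sqrt_nonneg A).trans_lt ha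
    have hb0 : 0 < b := (Real.sqrt_nonneg D).trans_lt hb
    have hA' : A ≤ a ^ 2 := (Real.sqrt_le_left ha0.le).1 ha.le
    have hD' : D ≤ b ^ 2 := (Real.sqrt_le_left hb0.le).1 hb.le
    calc x ≤ b / a * A + (b / a)⁻¹ * D := h _ (by positivity)
      _ ≤ b / a * a ^ 2 + (b / a)⁻¹ * b ^ 2 := by gcongr
      _ = 2 * (a * b) := by field_simp; ring
  have hlim : Tendsto (fun s : ℝ => 2 * ((√A + s) * (√D + s))) (𝓝[>] 0) (𝓝 (2 * (√A * √D))) := by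
    have : Continuous fun s : ℝ => 2 * ((√A + s) * (√D + s)) := by fun_prop
    simpa using (this.tendsto 0).mono_left nhdsWithin_le_nhds
  refine ge_of_tendsto hlim ?_
  filter_upwards [self_mem_nhdsWithin] with s hs
  exact key _ _ (lt_add_of_pos_right _ hs) (lt_add_of_pos_right _ hs)

/-! ### Square integrability of the strain and the divergence -/

theorem memLp_weakPartial {d : ℕ} (K : Set (E d)) (i : Fin d) (u : E d → ℝ) :
    MemLp (weakPartial K i u) 2 (volume.restrict K) := by
  rw [weakPartial]
  split_ifs with h
  · exact h.choose_spec.1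
  · exact MemLp.zero

theorem memLp_weakDiv {d : ℕ} (K : Set (E d)) (w : E d → E d) :
    MemLp (weakDiv K w) 2 (volume.restrict K) := by
  rw [weakDiv]
  split_ifs with h
  · exact h.choose_spec.1
  · exact MemLp.zero

theorem integrable_frob_strain {d : ℕ} (K : Set (E d)) (v : E d → E d) :
    IntegrableOn (fun x => frob (strain K v x) (strain K v x)) K := by
  refine integrable_frob_self fun i j => ?_
  have h : MemLp (fun x => strain K v x i j) 2 (volume.restrict K) := by
    simp only [strain, div_eq_mul_inv]
    exact ((memLp_weakPartial K j _).add (memLp_weakPartial K i _)).mul_const _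
  exact h.integrable_sq

/-! ### The terms of the bilinear form on an element and on a face -/

section Terms

variable {d : ℕ} {Ω : Set (E d)} {T : Mesh Ω} {σ γ : ℝ} {K F : Set (E d)}

/-- The terms on an element, split by Young's inequality with parameter `t`. -/
theorem abs_element_terms_le (M : Material d) (Φ : State d) (u : Triple d)
    (hτ : ∀ i j, MemLp (fun x => (Φ.τ x).1 i j) 2 (volume.restrict K))
    (hz : MemLp Φ.z 2 (volume.restrict K)) (hφ : MemLp Φ.φ 2 (volume.restrict K))
    {t : ℝ} (ht : 0 < t) :
    |(∫ x in K, frob (totalStress M (Φ.τ x).1 (Φ.z x) (Φ.φ x)) (strain K u.v x)) -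
      (∫ x in K, Φ.z x * weakDiv K u.w x) - (∫ x in K, Φ.φ x * weakDiv K u.s x)| ≤
    t * ((M.stressConst + 2) * ∫ x in K, energy (Φ.τ x).1 (Φ.z x) (Φ.φ x)) +
      t⁻¹ * ((∫ x in K, frob (strain K u.v x) (strain K u.v x)) +
        (∫ x in K, weakDiv K u.w x ^ 2) + ∫ x in K, weakDiv K u.s x ^ 2) := by
  have he : IntegrableOn (fun x => energy (Φ.τ x).1 (Φ.z x) (Φ.φ x)) K :=
    integrable_energy (fun i j => (hτ i j).integrable_sq) hz.integrable_sq hφ.integrable_sq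
  have h1 := abs_integral_le_young (s := t * M.stressConst) (t := t⁻¹) he
    (integrable_frob_strain K u.v)
    (f := fun x => frob (totalStress M (Φ.τ x).1 (Φ.z x) (Φ.φ x)) (strain K u.v x)) fun x => by
      refine (abs_frob_le_young ht _ _).trans ?_
      rw [mul_assoc]
      gcongr
      exact frob_totalStress_le M _ _ _
  have h2 := abs_integral_le_young (s := t) (t := t⁻¹) he (memLp_weakDiv K u.w).integrable_sq
    (f := fun x => Φ.z x * weakDiv K u.w x) fun x => by
      refine (abs_mul_le_young ht _ _).trans ?_
      gcongr
      exact le_add_of_le_of_nonneg (le_add_of_nonneg_left (frob_self_nonneg _)) (sq_nonneg _)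
  have h3 := abs_integral_le_young (s := t) (t := t⁻¹) he (memLp_weakDiv K u.s).integrable_sq
    (f := fun x => Φ.φ x * weakDiv K u.s x) fun x => by
      refine (abs_mul_le_young ht _ _).trans ?_
      gcongr
      exact le_add_of_nonneg_left (add_nonneg (frob_self_nonneg _) (sq_nonneg _))
  refine (abs_sub _ _).trans ((add_le_add ((abs_sub _ _).trans (add_le_add h1 h2)) h3).trans ?_)
  linarith

/-- The constant of the discrete trace inequality. -/
def traceConst (d : ℕ) (σ : ℝ) : ℝ := 4 * (2 * d + 1) ^ 2 * 2 ^ (d - 1) * σ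

theorem integral_face_energy_le (hd : 0 < d) (hT : T.ShapeRegular σ)
    (hT' : T.LocallyQuasiUniform γ) (hK : K ∈ T.cells) (hF : F ∈ T.facesOf K) {k : ℕ} {Φ : State d}
    (hτ : ∀ i j, IsPolyOn T K k fun x => (Φ.τ x).1 i j) (hz : IsPolyOn T K k Φ.z)
    (hφ : IsPolyOn T K k Φ.φ)
    (hτ2 : ∀ i j, MemLp (fun x => (Φ.τ x).1 i j) 2 (volume.restrict K))
    (hz2 : MemLp Φ.z 2 (volume.restrict K)) (hφ2 : MemLp Φ.φ 2 (volume.restrict K)) :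
    IntegrableOn (fun x => energy (mtrace K Φ.τ x) (trace K Φ.z x) (trace K Φ.φ x)) F (surf d) ∧
    Metric.diam F / ((k : ℝ) + 1) ^ 2 *
        ∫ x in F, energy (mtrace K Φ.τ x) (trace K Φ.z x) (trace K Φ.φ x) ∂(surf d) ≤
      traceConst d σ * ∫ x in K, energy (Φ.τ x).1 (Φ.z x) (Φ.φ x) := by
  have iτ (i j : Fin d) := integral_face_trace_sq_le hd hT hT' hK hF (hτ i j)
  have iz := integral_face_trace_sq_le hd hT hT' hK hF hz
  have iφ := integral_face_trace_sq_le hd hT hT' hK hF hφ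
  refine ⟨integrable_energy (fun i j => (iτ i j).1) iz.1 iφ.1, ?_⟩
  rw [integral_energy (A := mtrace K Φ.τ) (fun i j => (iτ i j).1) iz.1 iφ.1,
    integral_energy (fun i j => (hτ2 i j).integrable_sq) hz2.integrable_sq hφ2.integrable_sq]
  simp only [mul_add, Finset.mul_sum]
  refine add_le_add (add_le_add ?_ iz.2) iφ.2
  exact Finset.sum_le_sum fun i _ => Finset.sum_le_sum fun j _ => (iτ i j).2

/-- The terms on a face, with Young's parameter scaled by `h_F / (k + 1)²`, so that the discrete
trace inequality applies to one side and the other appears in the seminorm of `𝒰 × 𝒰̂`. -/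
theorem abs_face_terms_le (hd : 0 < d) (hT : T.ShapeRegular σ) (hT' : T.LocallyQuasiUniform γ)
    (hK : K ∈ T.cells) (hF : F ∈ T.facesOf K) {k : ℕ} (M : Material d) {Φ : State d}
    (hτ : ∀ i j, IsPolyOn T K k fun x => (Φ.τ x).1 i j) (hz : IsPolyOn T K k Φ.z)
    (hφ : IsPolyOn T K k Φ.φ)
    (hτ2 : ∀ i j, MemLp (fun x => (Φ.τ x).1 i j) 2 (volume.restrict K))
    (hz2 : MemLp Φ.z 2 (volume.restrict K)) (hφ2 : MemLp Φ.φ 2 (volume.restrict K))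
    (u : Triple d) {uh : HatTriple d} (huh : uh ∈ Uhat T) {t : ℝ} (ht : 0 < t) :
    |-(∫ x in F, inner ℝ
          (WithLp.toLp 2 ((totalStress M (mtrace K Φ.τ x) (trace K Φ.z x) (trace K Φ.φ x)).mulVec
            (normal K F)) : E d)
          (vtrace K u.v x - uh.v F x) ∂(surf d)) +
      (∫ x in F, inner ℝ (trace K Φ.z x • normal K F) (vtrace K u.w x - uh.w F x) ∂(surf d)) +
      ∫ x in F, inner ℝ (trace K Φ.φ x • normal K F) (vtrace K u.s x - uh.s F x) ∂(surf d)| ≤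
    t * ((M.stressConst + 2) * traceConst d σ * ∫ x in K, energy (Φ.τ x).1 (Φ.z x) (Φ.φ x)) +
      t⁻¹ * (((k : ℝ) + 1) ^ 2 / Metric.diam F *
        ∫ x in F, (‖vtrace K u.v x - uh.v F x‖ ^ 2 + ‖vtrace K u.w x - uh.w F x‖ ^ 2 +
          ‖vtrace K u.s x - uh.s F x‖ ^ 2) ∂(surf d)) := by
  obtain ⟨he, hle⟩ := integral_face_energy_le hd hT hT' hK hF hτ hz hφ hτ2 hz2 hφ2
  have hn : ‖normal K F‖ = 1 := (Mesh.isOutwardNormal_normal hT hK hF).1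
  have hmem : F ∈ T.faces := ⟨K, hK, hF⟩
  have hv := ((Mesh.memLp_vtrace_face hT hK hF u.v).sub (huh.1.1 F hmem)).integrable_norm_pow
    two_ne_zero
  have hw := ((Mesh.memLp_vtrace_face hT hK hF u.w).sub (huh.2.1 F hmem)).integrable_norm_pow
    two_ne_zero
  have hs := ((Mesh.memLp_vtrace_face hT hK hF u.s).sub (huh.2.2 F hmem)).integrable_norm_pow
    two_ne_zero
  simp only [Pi.sub_apply] at hv hw hs
  rw [integral_add (by exact hv.add hw) hs, integral_add hv hw]
  have hdF := Mesh.diam_face_pos hd hT hT' hK hF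
  set r := t * (Metric.diam F / ((k : ℝ) + 1) ^ 2) with hr
  have hr0 : 0 < r := by positivity
  have hri : r⁻¹ = t⁻¹ * (((k : ℝ) + 1) ^ 2 / Metric.diam F) := by rw [hr, mul_inv, inv_div]
  clear_value r
  have h1 := abs_integral_le_young (s := r * M.stressConst) (t := r⁻¹) he hv
    (f := fun x => inner ℝ
          (WithLp.toLp 2 ((totalStress M (mtrace K Φ.τ x) (trace K Φ.z x) (trace K Φ.φ x)).mulVec
            (normal K F)) : E d)
          (vtrace K u.v x - uh.v F x)) fun x => by
      refine (abs_inner_le_young hr0 _ _).trans ?_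
      rw [mul_assoc]
      gcongr
      exact (norm_mulVec_sq_le _ hn).trans (frob_totalStress_le M _ _ _)
  have h2 := abs_integral_le_young (s := r) (t := r⁻¹) he hw
    (f := fun x => inner ℝ (trace K Φ.z x • normal K F) (vtrace K u.w x - uh.w F x)) fun x => by
      refine (abs_inner_le_young hr0 _ _).trans ?_
      rw [norm_smul, hn, mul_one, Real.norm_eq_abs, sq_abs]
      gcongr
      exact le_add_of_le_of_nonneg (le_add_of_nonneg_left (frob_self_nonneg _)) (sq_nonneg _)
  have h3 := abs_integral_le_young (s := r) (t := r⁻¹) he hs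
    (f := fun x => inner ℝ (trace K Φ.φ x • normal K F) (vtrace K u.s x - uh.s F x)) fun x => by
      refine (abs_inner_le_young hr0 _ _).trans ?_
      rw [norm_smul, hn, mul_one, Real.norm_eq_abs, sq_abs]
      gcongr
      exact le_add_of_nonneg_left (add_nonneg (frob_self_nonneg _) (sq_nonneg _))
  rw [← abs_neg] at h1
  refine (abs_add_le _ _).trans
    ((add_le_add ((abs_add_le _ _).trans (add_le_add h1 h2)) h3).trans ?_)
  have hc : 0 ≤ t * (M.stressConst + 2) := by have := M.stressConst_pos; positivity
  have h4 := mul_le_mul_of_nonneg_left hle hc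
  rw [hri, hr]
  linarith

end Terms

/-! ### Summation over the mesh -/

section Sum

variable {d : ℕ} {Ω : Set (E d)} {T : Mesh Ω} {σ γ : ℝ}

/-- The contribution of the element `K` to the square of the seminorm of `𝒰 × 𝒰̂`. -/
def seminormTerm (T : Mesh Ω) (k : ℕ) (u : Triple d) (uh : HatTriple d) (K : Set (E d)) : ℝ :=
  (∫ x in K, frob (strain K u.v x) (strain K u.v x)) +
    (∫ x in K, weakDiv K u.w x ^ 2) + (∫ x in K, weakDiv K u.s x ^ 2) +
    ∑ᶠ F ∈ T.facesOf K, ((k : ℝ) + 1) ^ 2 / Metric.diam F *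
      ∫ x in F, (‖vtrace K u.v x - uh.v F x‖ ^ 2 + ‖vtrace K u.w x - uh.w F x‖ ^ 2 +
        ‖vtrace K u.s x - uh.s F x‖ ^ 2) ∂(surf d)

theorem Useminorm_eq (T : Mesh Ω) (k : ℕ) (u : Triple d) (uh : HatTriple d) :
    Useminorm T k u uh = √(∑ K ∈ T.cells, seminormTerm T k u uh K) := rfl

theorem abs_finsum_mem_le {α : Type*} {s : Set α} (hs : s.Finite) {f g : α → ℝ} {a b : ℝ}
    (h : ∀ i ∈ s, |f i| ≤ a + b * g i) :
    |∑ᶠ i ∈ s, f i| ≤ s.ncard * a + b * ∑ᶠ i ∈ s, g i := by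
  rw [finsum_mem_eq_finite_toFinset_sum _ hs, finsum_mem_eq_finite_toFinset_sum _ hs,
    Set.ncard_eq_toFinset_card _ hs, ← nsmul_eq_mul, ← Finset.sum_const, Finset.mul_sum,
    ← Finset.sum_add_distrib]
  exact (Finset.abs_sum_le_sum_abs _ _).trans
    (Finset.sum_le_sum fun i hi => h i (hs.mem_toFinset.1 hi))

/-- The bilinear form with a free parameter `t` between the two arguments. The number of faces of
an element enters, since each of its faces uses the energy of the whole element. -/
theorem abs_Bh_le_young (hd : 0 < d) (hd3 : d ≤ 3) (hΩ : IsLipschitzDomain Ω) (M : Material d)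
    (hT : T.ShapeRegular σ) (hT' : T.LocallyQuasiUniform γ) {k : ℕ} {Φ : State d}
    (hΦ : Φ ∈ H2h T k) (u : Triple d) {uh : HatTriple d} (huh : uh ∈ Uhat T) {t : ℝ}
    (ht : 0 < t) :
    |Bh M T Φ u uh| ≤
      t * ((M.stressConst + 2) * (1 + (|(γ + 1) * (γ * σ)| ^ d + 256) * traceConst d |σ|) *
        ∫ x in Ω, energy (Φ.τ x).1 (Φ.z x) (Φ.φ x)) +
      t⁻¹ * ∑ K ∈ T.cells, seminormTerm T k u uh K := by
  obtain ⟨hτ, hz, hφ⟩ := hΦ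
  set N : ℝ := |(γ + 1) * (γ * σ)| ^ d + 256
  have hN0 : 0 ≤ N := by positivity
  -- `σ` is positive as soon as there is an element, but the constant must not depend on that
  have htc : 0 ≤ traceConst d |σ| := by unfold traceConst; positivity
  have hsc := M.stressConst_pos
  have heK : ∀ K, 0 ≤ ∫ x in K, energy (Φ.τ x).1 (Φ.z x) (Φ.φ x) := fun K =>
    integral_nonneg fun x => energy_nonneg _ _ _
  have hcell : ∀ K ∈ T.cells,
      |(∫ x in K, frob (totalStress M (Φ.τ x).1 (Φ.z x) (Φ.φ x)) (strain K u.v x)) -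
        (∫ x in K, Φ.z x * weakDiv K u.w x) - (∫ x in K, Φ.φ x * weakDiv K u.s x)| +
      |∑ᶠ F ∈ T.facesOf K,
        (-(∫ x in F, inner ℝ
              (WithLp.toLp 2 ((totalStress M (mtrace K Φ.τ x) (trace K Φ.z x)
                (trace K Φ.φ x)).mulVec (normal K F)) : E d)
              (vtrace K u.v x - uh.v F x) ∂(surf d)) +
          (∫ x in F, inner ℝ (trace K Φ.z x • normal K F) (vtrace K u.w x - uh.w F x) ∂(surf d)) +
          ∫ x in F, inner ℝ (trace K Φ.φ x • normal K F) (vtrace K u.s x - uh.s F x) ∂(surf d))| ≤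
      t * ((M.stressConst + 2) * (1 + N * traceConst d |σ|)) *
        (∫ x in K, energy (Φ.τ x).1 (Φ.z x) (Φ.φ x)) + t⁻¹ * seminormTerm T k u uh K := by
    intro K hK
    have hle := Mesh.restrict_le hΩ hK
    have h1 := abs_element_terms_le M Φ u (fun i j => (hτ i j).1.mono_measure hle)
      (hz.1.mono_measure hle) (hφ.1.mono_measure hle) ht
    have h2 := abs_finsum_mem_le (T.finite_facesOf hK) fun F hF =>
      abs_face_terms_le hd hT hT' hK hF M (fun i j => (hτ i j).2 K hK) (hz.2 K hK) (hφ.2 K hK)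
        (fun i j => (hτ i j).1.mono_measure hle) (hz.1.mono_measure hle)
        (hφ.1.mono_measure hle) u huh ht
    have hcard := Mesh.ncard_facesOf_le hd hd3 hT hT' hK
    have hσ : traceConst d σ ≤ traceConst d |σ| := by
      unfold traceConst
      gcongr
      exact le_abs_self σ
    have h3 : ((T.facesOf K).ncard : ℝ) * (t * ((M.stressConst + 2) * traceConst d σ *
        ∫ x in K, energy (Φ.τ x).1 (Φ.z x) (Φ.φ x))) ≤
        N * (t * ((M.stressConst + 2) * traceConst d |σ| *
          ∫ x in K, energy (Φ.τ x).1 (Φ.z x) (Φ.φ x))) := by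
      have := heK K
      refine (mul_le_mul_of_nonneg_left ?_ (Nat.cast_nonneg _)).trans
        (mul_le_mul_of_nonneg_right hcard (by positivity))
      gcongr
    unfold seminormTerm
    linarith
  have hsum := Mesh.sum_integral_cells_le (T := T) hΩ (integrable_energy
    (fun i j => (hτ i j).1.integrable_sq) hz.1.integrable_sq hφ.1.integrable_sq)
    fun x => energy_nonneg (Φ.τ x).1 (Φ.z x) (Φ.φ x)
  calc |Bh M T Φ u uh| ≤ ∑ K ∈ T.cells, (t * ((M.stressConst + 2) * (1 + N * traceConst d |σ|)) *
        (∫ x in K, energy (Φ.τ x).1 (Φ.z x) (Φ.φ x)) + t⁻¹ * seminormTerm T k u uh K) := by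
        rw [Bh, ← Finset.sum_add_distrib]
        exact (Finset.abs_sum_le_sum_abs _ _).trans
          (Finset.sum_le_sum fun K hK => (abs_add_le _ _).trans (hcell K hK))
    _ = t * ((M.stressConst + 2) * (1 + N * traceConst d |σ|)) *
        (∑ K ∈ T.cells, ∫ x in K, energy (Φ.τ x).1 (Φ.z x) (Φ.φ x)) +
        t⁻¹ * ∑ K ∈ T.cells, seminormTerm T k u uh K := by
        rw [Finset.sum_add_distrib, Finset.mul_sum, Finset.mul_sum]
    _ ≤ _ := by
        rw [mul_assoc t]
        exact add_le_add_left (mul_le_mul_of_nonneg_left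
          (mul_le_mul_of_nonneg_left hsum (by positivity)) ht.le) _

end Sum

end

end HDG

theorem mainTheorem6 {d : ℕ} (hd : d = 2 ∨ d = 3) (Ω : Set (HDG.E d))
    (hΩ : HDG.IsLipschitzDomain Ω) (M : HDG.Material d) (r : ℝ) (hr : 1 / 2 < r) (σ γ : ℝ) :
    ∃ C : ℝ, 0 < C ∧ ∀ T : HDG.Mesh Ω, T.ShapeRegular σ → T.LocallyQuasiUniform γ →
      ∀ k : ℕ, ∀ Φ ∈ HDG.H2h T k, ∀ u ∈ HDG.U T r, ∀ uh ∈ HDG.Uhat T,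
        |HDG.Bh M T Φ u uh| ≤ C * HDG.H2norm Ω M Φ * HDG.Useminorm T k u uh := by
  obtain ⟨c, hc, hcoer⟩ := HDG.exists_integral_energy_le Ω M
  have hd0 : 0 < d := by omega
  have hd3 : d ≤ 3 := by omega
  set c' : ℝ := (M.stressConst + 2) *
    (1 + (|(γ + 1) * (γ * σ)| ^ d + 256) * HDG.traceConst d |σ|)
  have hc'0 : 0 < c' := by
    have h1 := M.stressConst_pos
    have h2 : 0 ≤ HDG.traceConst d |σ| := by unfold HDG.traceConst; positivity
    positivity
  refine ⟨2 * √(c' * c), by positivity, fun T hT hT' k Φ hΦ u _ uh huh => ?_⟩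
  have hH : 0 ≤ HDG.H2norm Ω M Φ := Real.sqrt_nonneg _
  have hbound := hcoer Φ (fun i j => (hΦ.1 i j).1) hΦ.2.1.1 hΦ.2.2.1
  have h := HDG.le_two_mul_sqrt_mul_sqrt fun t ht =>
    HDG.abs_Bh_le_young hd0 hd3 hΩ M hT hT' hΦ u huh ht
  rw [← HDG.Useminorm_eq] at h
  have hU : 0 ≤ HDG.Useminorm T k u uh := Real.sqrt_nonneg _
  calc _ ≤ _ := h
    _ ≤ 2 * (√(c' * c * HDG.H2norm Ω M Φ ^ 2) * HDG.Useminorm T k u uh) := by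
      rw [mul_assoc c']
      gcongr
    _ = 2 * √(c' * c) * HDG.H2norm Ω M Φ * HDG.Useminorm T k u uh := by
      rw [Real.sqrt_mul (by positivity), Real.sqrt_sq hH]
      ring
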